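/- Let $\mathcal X,\mathcal Y,\mathcal T$ be measurable spaces (inputs, labels, predictions), $\mathcal Z=\mathcal X\times\mathcal Y$, and let $\ell:\mathcal T\times\mathcal Y\to[0,1]$ be a measurable loss. Let $\mathcal H$ be a separable real Hilbert space (of finite or infinite dimension) with an orthonormal basis $(e_i)_{i\in I}$. For $m\in\mathcal H$ and $\sigma^2>0$ let $\mathcal N(m,\sigma^2 I)=\bigotimes_{i\in I}\mathcal N(\langle e_i,m\rangle,\sigma^2)$, a probability measure on $\mathbb R^I$, where $\mathcal H$ is identified with $\ell_2(I)\subseteq\mathbb R^I$ through the basis (if $\dim\mathcal H<\infty$ this is the usual Gaussian measure on $\mathcal H\cong\mathbb R^I$). The classifiers are the elements $c\in\mathbb R^I$: each of them determines a predictor $h_c:\mathcal X\to\mathcal T$, with $(c,x)\mapsto h_c(x)$ measurable. For a probability measure $P$ on $\mathcal Z$ and a probability measure $Q$ on $\mathbb R^I$ let $$R(c,P)=\int_{\mathcal Z}\ell(h_c(x),y)\,dP(x,y),\qquad R(Q,P)=\int_{\mathbb R^I} R(c,P)\,dQ(c).$$ For $q,q_0\in[0,1]$ let $$KL(q\Vert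 q_0)=q\log\tfrac{q}{q_0}+(1-q)\log\tfrac{1-q}{1-q_0}\in[0,\infty],\qquad KL_+(q\Vert q_0)=KL(q\Vert q_0)\,\mathbf 1[q<q_0],$$ with $0\log\frac{0}{b}=0$ and $a\log\frac a0=\infty$ for $a>0$. Let $\mathsf A:\bigcup_n\mathcal Z^n\to\mathcal H$ be a learning algorithm (measurable on each $\mathcal Z^n$), with hypothesis sensitivity coefficients $$\beta_n=\sup_{1\le i\le n}\ \sup_{z_1,\dots,z_n,z_i'\in\mathcal Z}\bigl\Vert \mathsf A(z_1,\dots,z_{i-1},z_i,z_{i+1},\dots,z_n)-\mathsf A(z_1,\dots,z_{i-1},z_i',z_{i+1},\dots,z_n)\bigr\Vert_{\mathcal H}\in[0,\infty].$$ **Theorem.** Let $P$ be a probability measure on $\mathcal Z$, $n\ge1$, $\sigma^2>0$ and $\delta\in(0,1)$. Let $S_n=(Z_1,\dots,Z_n)\sim P^{n}$ be an i.i.d. sample with empirical measure $P_n=\frac1n\sum_{i=1}^n\delta_{Z_i}$, and let $Q=\mathcal N(\mathsf A(S_n),\sigma^2 I)$. Then with probability at least $1-2\delta$ over the sample, $$KL_+\bigl(R(Q,P_n)\,\Vert\,R(Q,P)\bigr)\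 \le\ \frac{\dfrac{n\beta_n^2}{2\sigma^2}\Bigl(1+\sqrt{\tfrac12\log\bigl(\tfrac1\delta\bigr)}\Bigr)^2+\log\bigl(\tfrac{n+1}{\delta}\bigr)}{n}.$$ -/

import Mathlib

open MeasureTheory ProbabilityTheory
open scoped ENNReal NNReal

noncomputable section

namespace StablePACBayes

/-- The `n`-th hypothesis sensitivity coefficient of a Hilbert space valued algorithm `A`: the
largest possible norm of the change of `A(z₁, …, zₙ)` when one entry of the sample is replaced.
It is a supremum in `[0, ∞]`. -/
def sensitivity {Z H : Type*} [NormedAddCommGroup H]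
    (A : (n : ℕ) → (Fin n → Z) → H) (n : ℕ) : ℝ≥0∞ :=
  ⨆ (i : Fin n) (z : Fin n → Z) (z' : Z), ‖A n z - A n (Function.update z i z')‖ₑ

/-- The Gaussian distribution `𝒩(m, v I)` with mean `m` in the Hilbert space `H` and covariance
`v I`. The orthonormal basis `b` identifies `H` with `ℓ²(ι) ⊆ ℝ^ι`, and `𝒩(m, v I)` is the product
measure on `ℝ^ι` of the one-dimensional Gaussians `𝒩(mᵢ, v)`, where `mᵢ = ⟪b i, m⟫`. If `H` is
finite dimensional then `ℝ^ι` is `H` itself in the coordinates given by `b`. -/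
def gaussian {ι H : Type*} [NormedAddCommGroup H] [InnerProductSpace ℝ H]
    (b : HilbertBasis ι ℝ H) (m : H) (v : ℝ≥0) : Measure (ι → ℝ) :=
  Measure.infinitePi fun i => gaussianReal (b.repr m i) v

/-- The empirical measure `Pₙ = (1/n) ∑ᵢ δ_{zᵢ}` of a sample. -/
def empiricalMeasure {Z : Type*} [MeasurableSpace Z] {n : ℕ} (s : Fin n → Z) : Measure Z :=
  (n : ℝ≥0∞)⁻¹ • ∑ i, Measure.dirac (s i)

/-- The risk `R(h, P) = ∫ ℓ(h(x), y) dP(x, y)` of a predictor `h`. -/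
def risk {X Y T : Type*} [MeasurableSpace X] [MeasurableSpace Y]
    (loss : T → Y → ℝ) (h : X → T) (P : Measure (X × Y)) : ℝ :=
  ∫ z, loss (h z.1) z.2 ∂P

/-- The average risk `R(Q, P) = ∫ R(c, P) dQ(c)` of the randomized classifier `Q`, where `pred c`
is the predictor that the classifier `c` represents. -/
def avgRisk {C X Y T : Type*} [MeasurableSpace C] [MeasurableSpace X] [MeasurableSpace Y]
    (loss : T → Y → ℝ) (pred : C → X → T) (Q : Measure C) (P : Measure (X × Y)) : ℝ :=
  ∫ c, risk loss (pred c) P ∂Q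

/-- `a log (a / b)` for `a, b ≥ 0`, with the conventions `0 log (0 / b) = 0` and
`a log (a / 0) = ∞` for `a > 0`. -/
def klTerm (a b : ℝ) : EReal :=
  if a = 0 then 0 else if b = 0 then ⊤ else ((a * Real.log (a / b) : ℝ) : EReal)

/-- `KL(q ‖ q₀) = q log (q / q₀) + (1 - q) log ((1 - q) / (1 - q₀))`, the relative entropy of
Bernoulli distributions with parameters `q, q₀ ∈ [0, 1]`. -/
def klBernoulli (q q₀ : ℝ) : EReal :=
  klTerm q q₀ + klTerm (1 - q) (1 - q₀)

/-- `KL₊(q ‖ q₀) = KL(q ‖ q₀) 𝟏[q < q₀]`. -/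
def klPlus (q q₀ : ℝ) : EReal :=
  if q < q₀ then klBernoulli q q₀ else 0

end StablePACBayes

end

/-! Take as prior the Gaussian `Q₀` centred at the mean `m = E A(Sₙ)`. It depends on `P` but not on
the sample, so it is a legitimate PAC-Bayes prior. The divergence of the posterior from it is
`‖A(Sₙ) - m‖² / (2σ²)`, and stability keeps this small. Two events of probability at most `δ` are
discarded.

Concentration: orthogonality of martingale increments gives `E‖A(Sₙ) - m‖ ≤ √n β`. The norm itself
has differences bounded by `β`, so McDiarmid's inequality adds a fluctuation `√n β √(½ log(1/δ))`.

Deviation: for a fixed classifier with risk `p`, the likelihood ratios of Bernoulli(`q`) against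
Bernoulli(`p`), evaluated at losses in `[0, 1]`, have mean at most `1`. Their uniform mixture over
`q`, times `n + 1`, dominates every single ratio (`prod_bernoulliRatio_le_bernoulliMixture`), hence
every exponential `exp(t ∑ xᵢ - n log(1 - p + p eᵗ))`. Averaging over `Q₀` and applying Markov's
inequality costs `log((n+1)/δ)` once for all `t`.

Outside both events, the Donsker-Varadhan inequality passes from `Q₀` to the posterior for each `t`,
Jensen's inequality moves the average over classifiers inside the logarithm, and the Legendre
formula for the Bernoulli divergence (`klPlus_le_of_forall`) optimizes over `t`. In infinite
dimension the change of measure follows from finite products by cylinder approximation. -/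

namespace StablePACBayes

/-! ### Concentration of functions with bounded differences -/

section Concentration

variable {Z : Type*}

/-- The coordinates are exchanged one at a time, each at cost `c`. The resulting global bound
supplies integrability everywhere below. -/
theorem norm_sub_le_of_boundedDifferences {E : Type*} [SeminormedAddCommGroup E] {n : ℕ}
    {f : (Fin n → Z) → E} {c : ℝ}
    (hf : ∀ i z z', ‖f z - f (Function.update z i z')‖ ≤ c) (z w : Fin n → Z) :
    ‖f z - f w‖ ≤ n * c := by
  have key : ∀ s : Finset (Fin n), ‖f z - f (s.piecewise w z)‖ ≤ s.card * c := by
    intro s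
    induction s using Finset.induction_on with
    | empty => simp
    | insert j s hj ih =>
      rw [Finset.piecewise_insert, Finset.card_insert_of_notMem hj]
      have := norm_sub_le_norm_sub_add_norm_sub (f z) (f (s.piecewise w z))
        (f (Function.update (s.piecewise w z) j (w j)))
      have h2 := hf j (s.piecewise w z) (w j)
      push_cast
      linarith
  simpa using key Finset.univ

theorem norm_sub_integral_le {Ω E : Type*} [MeasurableSpace Ω] [NormedAddCommGroup E]
    [NormedSpace ℝ E] [CompleteSpace E] {μ : Measure Ω} [IsProbabilityMeasure μ] {f : Ω → E}
    (hf : Integrable f μ) {a : E} {c : ℝ} (h : ∀ x, ‖a - f x‖ ≤ c) : ‖a - ∫ x, f x ∂μ‖ ≤ c := by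
  have : a - ∫ x, f x ∂μ = ∫ x, (a - f x) ∂μ := by
    rw [integral_sub (integrable_const _) hf]; simp
  rw [this]
  refine (norm_integral_le_of_norm_le_const (C := c) (ae_of_all _ h)).trans ?_
  simp

theorem integrable_of_dist_bounded {Ω E : Type*} [MeasurableSpace Ω] [NormedAddCommGroup E]
    {μ : Measure Ω} [IsProbabilityMeasure μ] {f : Ω → E}
    (hm : AEStronglyMeasurable f μ) {c : ℝ} (h : ∀ x y, ‖f x - f y‖ ≤ c) : Integrable f μ := by
  obtain ⟨x₀⟩ := nonempty_of_isProbabilityMeasure μ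
  refine Integrable.of_bound hm (‖f x₀‖ + c) (ae_of_all _ fun x => ?_)
  have := norm_le_norm_add_norm_sub' (f x) (f x₀)
  linarith [h x x₀]

theorem measurable_fin_cons [MeasurableSpace Z] (n : ℕ) :
    Measurable fun p : Z × (Fin n → Z) => (Fin.cons p.1 p.2 : Fin (n + 1) → Z) := by
  refine measurable_pi_lambda _ fun i => ?_
  refine Fin.cases ?_ (fun j => ?_) i
  · simpa using measurable_fst
  · simp only [Fin.cons_succ]; fun_prop

theorem measurePreserving_fin_cons [MeasurableSpace Z] (P : Measure Z) [SigmaFinite P] (n : ℕ) :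
    MeasurePreserving (fun p : Z × (Fin n → Z) => (Fin.cons p.1 p.2 : Fin (n + 1) → Z))
      (P.prod (Measure.pi fun _ : Fin n => P)) (Measure.pi fun _ : Fin (n + 1) => P) := by
  have h := (measurePreserving_piFinSuccAbove (fun _ : Fin (n + 1) => P) 0).symm
  convert h using 1
  ext p i
  simp [MeasurableEquiv.piFinSuccAbove]

theorem integral_pi_succ {E : Type*} [NormedAddCommGroup E] [NormedSpace ℝ E]
    [MeasurableSpace Z] (P : Measure Z) [IsProbabilityMeasure P] (n : ℕ)
    {f : (Fin (n + 1) → Z) → E} (hf : Integrable f (Measure.pi fun _ => P)) :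
    ∫ s, f s ∂(Measure.pi fun _ => P) =
      ∫ x, ∫ r, f (Fin.cons x r) ∂(Measure.pi fun _ => P) ∂P := by
  have hp := measurePreserving_fin_cons P n
  rw [← hp.map_eq, integral_map hp.measurable.aemeasurable
    (by rw [hp.map_eq]; exact hf.aestronglyMeasurable)]
  exact integral_prod _ (hp.integrable_comp_of_integrable hf)

theorem boundedDifferences_cons {E : Type*} [SeminormedAddCommGroup E] {n : ℕ}
    {f : (Fin (n + 1) → Z) → E} {c : ℝ}
    (hf : ∀ i z z', ‖f z - f (Function.update z i z')‖ ≤ c) (x : Z) (i : Fin n) (z : Fin n → Z)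
    (z' : Z) : ‖f (Fin.cons x z) - f (Fin.cons x (Function.update z i z'))‖ ≤ c := by
  rw [Fin.cons_update]
  exact hf _ _ _

/-- Averaging over the remaining coordinates does not increase the oscillation. This controls the
first increment of the Doob martingale of `f`. -/
theorem norm_integral_cons_sub_le {E : Type*} [NormedAddCommGroup E] [NormedSpace ℝ E]
    [CompleteSpace E] [MeasurableSpace Z] (P : Measure Z) [IsProbabilityMeasure P] {n : ℕ}
    {f : (Fin (n + 1) → Z) → E} {c : ℝ} (hm : StronglyMeasurable f)
    (hf : ∀ i z z', ‖f z - f (Function.update z i z')‖ ≤ c) (x y : Z) :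
    ‖∫ r, f (Fin.cons x r) ∂(Measure.pi fun _ : Fin n => P) -
      ∫ r, f (Fin.cons y r) ∂(Measure.pi fun _ : Fin n => P)‖ ≤ c := by
  have hi : ∀ x, Integrable (fun r => f (Fin.cons x r)) (Measure.pi fun _ : Fin n => P) := fun x =>
    integrable_of_dist_bounded (hm.comp_measurable
      ((measurable_fin_cons n).comp measurable_prodMk_left)).aestronglyMeasurable
      (norm_sub_le_of_boundedDifferences (boundedDifferences_cons hf x))
  rw [← integral_sub (hi x) (hi y)]
  refine (norm_integral_le_of_norm_le_const (C := c) (ae_of_all _ fun r => ?_)).trans (by simp)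
  have := hf 0 (Fin.cons x r) y
  rwa [Fin.update_cons_zero] at this

/-- Hoeffding's lemma: `g` takes values in an interval of length `c` starting at its infimum, so its
variance proxy is `(c / 2)²`. -/
theorem integral_exp_le_of_oscillation {Ω : Type*} [MeasurableSpace Ω] {μ : Measure Ω}
    [IsProbabilityMeasure μ] {g : Ω → ℝ} {c : ℝ} (hm : Measurable g)
    (hg : ∀ x y, ‖g x - g y‖ ≤ c) (t : ℝ) :
    ∫ x, Real.exp (t * (g x - ∫ y, g y ∂μ)) ∂μ ≤ Real.exp (c ^ 2 / 4 * t ^ 2 / 2) := by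
  obtain ⟨x₀⟩ := nonempty_of_isProbabilityMeasure μ
  have hbdd : BddBelow (Set.range g) := ⟨g x₀ - c, by
    rintro _ ⟨x, rfl⟩
    have := (abs_le.1 (hg x₀ x)).2
    linarith⟩
  have : Nonempty Ω := ⟨x₀⟩
  have hI : ∀ᵐ x ∂μ, g x ∈ Set.Icc (⨅ x, g x) ((⨅ x, g x) + c) := ae_of_all _ fun x => by
    refine ⟨ciInf_le hbdd x, ?_⟩
    have : g x - c ≤ ⨅ x, g x := le_ciInf fun y => by
      have := (abs_le.1 (hg x y)).2
      linarith
    linarith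
  have h := (hasSubgaussianMGF_of_mem_Icc hm.aemeasurable hI).mgf_le t
  refine h.trans (le_of_eq ?_)
  rw [add_sub_cancel_left]
  simp only [NNReal.coe_pow, NNReal.coe_div, coe_nnnorm, Real.norm_eq_abs, div_pow, sq_abs]
  norm_num

/-- The moment generating function bound behind McDiarmid's inequality. -/
theorem integral_exp_le_of_boundedDifferences [MeasurableSpace Z] (P : Measure Z)
    [IsProbabilityMeasure P] {n : ℕ} {f : (Fin n → Z) → ℝ} {c : ℝ} (hm : Measurable f)
    (hf : ∀ i z z', ‖f z - f (Function.update z i z')‖ ≤ c) (t : ℝ) :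
    ∫ s, Real.exp (t * (f s - ∫ s, f s ∂(Measure.pi fun _ => P))) ∂(Measure.pi fun _ => P) ≤
      Real.exp (n * c ^ 2 / 4 * t ^ 2 / 2) := by
  induction n with
  | zero =>
    have : ∀ s, f s = f default := fun s => congrArg f (Subsingleton.elim _ _)
    simp [this]
  | succ n ih =>
    have hbd := norm_sub_le_of_boundedDifferences hf
    have hfi : Integrable f (Measure.pi fun _ => P) :=
      integrable_of_dist_bounded hm.aestronglyMeasurable hbd
    have hmc : ∀ x, Measurable fun r => f (Fin.cons x r : Fin (n + 1) → Z) := fun x =>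
      hm.comp ((measurable_fin_cons n).comp measurable_prodMk_left)
    set g : Z → ℝ := fun x => ∫ r, f (Fin.cons x r) ∂(Measure.pi fun _ : Fin n => P) with hg
    have hgm : Measurable g :=
      (hm.comp (measurable_fin_cons n)).stronglyMeasurable.integral_prod_right'.measurable
    have hgb : ∀ x y, ‖g x - g y‖ ≤ c := norm_integral_cons_sub_le P hm.stronglyMeasurable hf
    have hEf : ∫ s, f s ∂(Measure.pi fun _ => P) = ∫ x, g x ∂P := integral_pi_succ P n hfi
    set m := ∫ x, g x ∂P with hmdef
    rw [hEf]
    have hexp_i : ∀ {Ω : Type _} [MeasurableSpace Ω] (μ : Measure Ω) [IsProbabilityMeasure μ]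
        (u : Ω → ℝ) (_ : Measurable u) (C a : ℝ) (_ : ∀ x y, ‖u x - u y‖ ≤ C),
        Integrable (fun x => Real.exp (t * (u x - a))) μ := by
      intro Ω _ μ _ u hu C a hC
      obtain ⟨x₀⟩ := nonempty_of_isProbabilityMeasure μ
      refine Integrable.of_bound (by fun_prop) (Real.exp (|t| * (C + |u x₀ - a|)))
        (ae_of_all _ fun x => ?_)
      rw [Real.norm_eq_abs, Real.abs_exp]
      refine Real.exp_le_exp.2 ((le_abs_self _).trans ?_)
      rw [abs_mul]
      gcongr
      have := abs_add_le (u x - u x₀) (u x₀ - a)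
      rw [sub_add_sub_cancel] at this
      exact this.trans (by gcongr; exact hC x x₀)
    rw [integral_pi_succ P n (hexp_i _ f hm _ m hbd)]
    -- Given the first coordinate `x`, write `f - m = (f - g x) + (g x - m)`. The induction
    -- hypothesis handles the first term, and Hoeffding's lemma will handle the second.
    have hstep : ∀ x, ∫ r, Real.exp (t * (f (Fin.cons x r) - m)) ∂(Measure.pi fun _ : Fin n => P)
        ≤ Real.exp (t * (g x - m)) * Real.exp (n * c ^ 2 / 4 * t ^ 2 / 2) := by
      intro x
      have h1 := ih (hmc x) (boundedDifferences_cons hf x)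
      have h2 : ∀ r, Real.exp (t * (f (Fin.cons x r) - m)) =
          Real.exp (t * (g x - m)) * Real.exp (t * (f (Fin.cons x r) - g x)) := fun r => by
        rw [← Real.exp_add]; ring_nf
      simp_rw [h2]
      rw [integral_const_mul]
      exact mul_le_mul_of_nonneg_left h1 (Real.exp_nonneg _)
    have hgi := hexp_i P g hgm _ m hgb
    calc _ ≤ ∫ x, Real.exp (t * (g x - m)) * Real.exp (n * c ^ 2 / 4 * t ^ 2 / 2) ∂P :=
          integral_mono_of_nonneg (ae_of_all _ fun x => integral_nonneg fun r => Real.exp_nonneg _)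
            (hgi.mul_const _) (ae_of_all _ hstep)
      _ = (∫ x, Real.exp (t * (g x - m)) ∂P) * Real.exp (n * c ^ 2 / 4 * t ^ 2 / 2) :=
          integral_mul_const _ _
      _ ≤ Real.exp (c ^ 2 / 4 * t ^ 2 / 2) * Real.exp (n * c ^ 2 / 4 * t ^ 2 / 2) := by
          gcongr
          exact integral_exp_le_of_oscillation hgm hgb t
      _ = _ := by
          rw [← Real.exp_add]; push_cast; ring_nf

/-- McDiarmid's inequality. -/
theorem measure_ge_le_of_boundedDifferences [MeasurableSpace Z] (P : Measure Z)
    [IsProbabilityMeasure P] {n : ℕ} {f : (Fin n → Z) → ℝ} {c : ℝ} (hm : Measurable f)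
    (hf : ∀ i z z', ‖f z - f (Function.update z i z')‖ ≤ c) {ε : ℝ} (hε : 0 ≤ ε) :
    (Measure.pi fun _ => P).real {s | ε ≤ f s - ∫ s, f s ∂(Measure.pi fun _ => P)} ≤
      Real.exp (-ε ^ 2 / (2 * (n * c ^ 2 / 4))) := by
  set μ := (Measure.pi fun _ : Fin n => P)
  have hfb := norm_sub_le_of_boundedDifferences hf
  have hfi : Integrable f μ := integrable_of_dist_bounded hm.aestronglyMeasurable hfb
  have hsg : HasSubgaussianMGF (fun s => f s - ∫ s, f s ∂μ)
      ⟨n * c ^ 2 / 4, by positivity⟩ μ := by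
    refine ⟨fun t => ?_, fun t => integral_exp_le_of_boundedDifferences P hm hf t⟩
    refine integrable_exp_mul_of_mem_Icc (a := -(n * c)) (b := n * c) (by fun_prop)
      (ae_of_all _ fun s => ?_)
    exact abs_le.1 (norm_sub_integral_le hfi (hfb s))
  exact hsg.measure_ge_le hε

/-- Bias-variance decomposition: the cross term has mean zero. -/
theorem integral_norm_sub_sq_eq {Ω H : Type*} [MeasurableSpace Ω] [NormedAddCommGroup H]
    [InnerProductSpace ℝ H] [CompleteSpace H] {μ : Measure Ω} [IsProbabilityMeasure μ] {f : Ω → H}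
    (hm : AEStronglyMeasurable f μ) {c : ℝ} (hf : ∀ x y, ‖f x - f y‖ ≤ c) (a : H) :
    ∫ x, ‖f x - a‖ ^ 2 ∂μ = ∫ x, ‖f x - ∫ y, f y ∂μ‖ ^ 2 ∂μ + ‖∫ y, f y ∂μ - a‖ ^ 2 := by
  have hfi := integrable_of_dist_bounded hm hf
  set m := ∫ y, f y ∂μ with hmdef
  have h : ∀ x, ‖f x - a‖ ^ 2 = ‖f x - m‖ ^ 2 + 2 * inner ℝ (m - a) (f x - m) + ‖m - a‖ ^ 2 := by
    intro x
    rw [← sub_add_sub_cancel (f x) m a, norm_add_sq_real, real_inner_comm]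
  have hi1 : Integrable (fun x => ‖f x - m‖ ^ 2) μ := by
    refine Integrable.of_bound (by fun_prop) (c ^ 2) (ae_of_all _ fun x => ?_)
    rw [Real.norm_eq_abs, abs_of_nonneg (by positivity)]
    have := norm_sub_integral_le hfi (hf x)
    gcongr
  have hi2 : Integrable (fun x => 2 * inner ℝ (m - a) (f x - m)) μ :=
    ((hfi.sub (integrable_const m)).const_inner (m - a)).const_mul 2
  simp_rw [h]
  rw [integral_add (f := fun x => ‖f x - m‖ ^ 2 + 2 * inner ℝ (m - a) (f x - m)) (hi1.add hi2)
    (integrable_const _), integral_add hi1 hi2, integral_const_mul,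
    integral_inner (f := fun x => f x - m) (hfi.sub (integrable_const m)),
    integral_sub hfi (integrable_const m)]
  simp [← hmdef]

/-- An Efron-Stein type variance bound for functions with bounded differences. -/
theorem integral_norm_sub_sq_le_of_boundedDifferences {H : Type*} [NormedAddCommGroup H]
    [InnerProductSpace ℝ H] [CompleteSpace H] [MeasurableSpace Z] (P : Measure Z)
    [IsProbabilityMeasure P] {n : ℕ} {f : (Fin n → Z) → H} {c : ℝ} (hm : StronglyMeasurable f)
    (hf : ∀ i z z', ‖f z - f (Function.update z i z')‖ ≤ c) :
    ∫ s, ‖f s - ∫ s, f s ∂(Measure.pi fun _ => P)‖ ^ 2 ∂(Measure.pi fun _ => P) ≤ n * c ^ 2 := by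
  induction n with
  | zero =>
    have : ∀ s, f s = f default := fun s => congrArg f (Subsingleton.elim _ _)
    simp [this]
  | succ n ih =>
    have hbd := norm_sub_le_of_boundedDifferences hf
    have hfi : Integrable f (Measure.pi fun _ => P) :=
      integrable_of_dist_bounded hm.aestronglyMeasurable hbd
    have hmc : ∀ x, StronglyMeasurable fun r => f (Fin.cons x r : Fin (n + 1) → Z) := fun x =>
      hm.comp_measurable ((measurable_fin_cons n).comp measurable_prodMk_left)
    set g : Z → H := fun x => ∫ r, f (Fin.cons x r) ∂(Measure.pi fun _ : Fin n => P) with hg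
    have hgm : StronglyMeasurable g :=
      (hm.comp_measurable (measurable_fin_cons n)).integral_prod_right'
    have hgb : ∀ x y, ‖g x - g y‖ ≤ c := norm_integral_cons_sub_le P hm hf
    have hEf : ∫ s, f s ∂(Measure.pi fun _ => P) = ∫ x, g x ∂P := integral_pi_succ P n hfi
    set m := ∫ x, g x ∂P with hmdef
    have hgi := integrable_of_dist_bounded hgm.aestronglyMeasurable (μ := P) hgb
    have hfsm : ∀ s, ‖f s - m‖ ≤ (n + 1 : ℕ) * c := fun s => by
      rw [← hEf]; exact norm_sub_integral_le hfi (hbd s)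
    have hgsm : ∀ x, ‖g x - m‖ ≤ c := fun x => norm_sub_integral_le hgi (hgb x)
    have hint : Integrable (fun s => ‖f s - m‖ ^ 2) (Measure.pi fun _ => P) := by
      refine Integrable.of_bound (by fun_prop) (((n + 1 : ℕ) * c) ^ 2) (ae_of_all _ fun x => ?_)
      rw [Real.norm_eq_abs, abs_of_nonneg (by positivity)]
      have := hfsm x
      gcongr
    rw [hEf, integral_pi_succ P n hint]
    -- Split around the conditional mean `g x`: the conditional variance falls to the induction
    -- hypothesis, and the squared increment `‖g x - m‖²` is at most `c²`.
    have hstep : ∀ x, ∫ r, ‖f (Fin.cons x r) - m‖ ^ 2 ∂(Measure.pi fun _ : Fin n => P)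
        ≤ n * c ^ 2 + c ^ 2 := by
      intro x
      rw [integral_norm_sub_sq_eq (hmc x).aestronglyMeasurable
        (norm_sub_le_of_boundedDifferences (boundedDifferences_cons hf x)) m]
      have h1 := ih (hmc x) (boundedDifferences_cons hf x)
      have h2 := hgsm x
      refine add_le_add h1 ?_
      gcongr
    calc _ ≤ ∫ _, (n * c ^ 2 + c ^ 2) ∂P :=
          integral_mono_of_nonneg (ae_of_all _ fun x => integral_nonneg fun r => by positivity)
            (integrable_const _) (ae_of_all _ hstep)
      _ = _ := by simp; ring

/-- The variance of the norm is nonnegative, so its squared mean is at most its second moment. -/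
theorem integral_norm_sub_le_of_boundedDifferences {H : Type*} [NormedAddCommGroup H]
    [InnerProductSpace ℝ H] [CompleteSpace H] [MeasurableSpace Z] (P : Measure Z)
    [IsProbabilityMeasure P] {n : ℕ} {f : (Fin n → Z) → H} {c : ℝ} (hc : 0 ≤ c)
    (hm : StronglyMeasurable f)
    (hf : ∀ i z z', ‖f z - f (Function.update z i z')‖ ≤ c) :
    ∫ s, ‖f s - ∫ s, f s ∂(Measure.pi fun _ => P)‖ ∂(Measure.pi fun _ => P) ≤ √n * c := by
  set μ := (Measure.pi fun _ : Fin n => P)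
  have hbd := norm_sub_le_of_boundedDifferences hf
  have hfi : Integrable f μ := integrable_of_dist_bounded hm.aestronglyMeasurable hbd
  have hle := fun s => norm_sub_integral_le hfi (hbd s)
  have h := integral_norm_sub_sq_le_of_boundedDifferences P hm hf
  have hmem : MemLp (fun s => ‖f s - ∫ s, f s ∂μ‖) 2 μ :=
    MemLp.of_bound (by fun_prop) (n * c) (ae_of_all _ fun s => by simpa using hle s)
  have hv := variance_nonneg (fun s => ‖f s - ∫ s, f s ∂μ‖) μ
  rw [variance_eq_sub hmem] at hv
  refine le_of_sq_le_sq ?_ (by positivity)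
  rw [mul_pow, Real.sq_sqrt (by positivity)]
  simp only [Pi.pow_apply] at hv
  linarith

/-- Concentration of a stable Hilbert space valued function around its mean. -/
theorem measure_norm_sub_integral_gt_le {H : Type*} [NormedAddCommGroup H]
    [InnerProductSpace ℝ H] [CompleteSpace H] [MeasurableSpace Z] (P : Measure Z)
    [IsProbabilityMeasure P] {n : ℕ} {f : (Fin n → Z) → H} {c : ℝ} (hc : 0 ≤ c)
    (hm : StronglyMeasurable f)
    (hf : ∀ i z z', ‖f z - f (Function.update z i z')‖ ≤ c) {δ : ℝ} (hδ : δ ∈ Set.Ioo (0 : ℝ) 1) :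
    (Measure.pi fun _ => P) {s | √n * c * (1 + √(1 / 2 * Real.log (1 / δ))) <
      ‖f s - ∫ s, f s ∂(Measure.pi fun _ => P)‖} ≤ ENNReal.ofReal δ := by
  set μ := (Measure.pi fun _ : Fin n => P)
  have hbd := norm_sub_le_of_boundedDifferences hf
  have hfi : Integrable f μ := integrable_of_dist_bounded hm.aestronglyMeasurable hbd
  have hle := fun s => norm_sub_integral_le hfi (hbd s)
  -- If `n * c = 0`, McDiarmid's exponent divides by zero and says nothing, but then `f` equals its
  -- mean.
  rcases (mul_nonneg n.cast_nonneg hc : (0 : ℝ) ≤ n * c).eq_or_lt with h0 | h0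
  · refine le_of_eq_of_le ?_ (zero_le (a := ENNReal.ofReal δ))
    refine measure_mono_null (fun s hs => ?_) (measure_empty (μ := μ))
    have h1 := hle s
    rw [← h0] at h1
    have h2 : (0 : ℝ) ≤ √n * c * (1 + √(1 / 2 * Real.log (1 / δ))) := by positivity
    exact absurd (lt_of_le_of_lt h2 hs) (not_lt.2 h1)
  have hL : 0 < Real.log (1 / δ) := Real.log_pos (by rw [lt_div_iff₀ hδ.1]; linarith [hδ.2])
  have hgm : Measurable fun s => ‖f s - ∫ s, f s ∂μ‖ :=
    (hm.sub stronglyMeasurable_const).norm.measurable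
  have hgd : ∀ i z z', ‖‖f z - ∫ s, f s ∂μ‖ - ‖f (Function.update z i z') - ∫ s, f s ∂μ‖‖ ≤ c := by
    intro i z z'
    refine (abs_norm_sub_norm_le _ _).trans ?_
    rw [sub_sub_sub_cancel_right]
    exact hf i z z'
  -- This `ε` solves `2ε² / (n c²) = log(1/δ)`.
  have hmc := measure_ge_le_of_boundedDifferences P hgm hgd
    (ε := √n * c * √(1 / 2 * Real.log (1 / δ))) (by positivity)
  have hmean := integral_norm_sub_le_of_boundedDifferences P hc hm hf
  have hval : -(√n * c * √(1 / 2 * Real.log (1 / δ))) ^ 2 / (2 * (n * c ^ 2 / 4)) = Real.log δ := by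
    have hn : (n : ℝ) ≠ 0 := by rintro h; simp [h] at h0
    have hc' : c ≠ 0 := by rintro h; simp [h] at h0
    rw [mul_pow, mul_pow, Real.sq_sqrt (by positivity), Real.sq_sqrt (by positivity), one_div δ,
      Real.log_inv]
    field_simp
    ring
  rw [hval, Real.exp_log hδ.1] at hmc
  rw [← ofReal_measureReal]
  refine ENNReal.ofReal_le_ofReal (le_trans (measureReal_mono fun s hs => ?_) hmc)
  simp only [Set.mem_ofPred_eq] at hs ⊢
  linarith

end Concentration

/-! ### Change of measure between Gaussian products -/

section ChangeOfMeasure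

open Filter Topology

theorem lintegral_pi_prod {κ : Type*} [Fintype κ] {E : κ → Type*} [∀ i, MeasurableSpace (E i)]
    (μ : ∀ i, Measure (E i)) [∀ i, IsProbabilityMeasure (μ i)] {f : ∀ i, E i → ℝ≥0∞}
    (hf : ∀ i, Measurable (f i)) :
    ∫⁻ x, ∏ i, f i (x i) ∂(Measure.pi μ) = ∏ i, ∫⁻ x, f i x ∂(μ i) := by
  have h := lintegral_prod_eq_prod_lintegral_of_indepFun Finset.univ
    (fun i (x : ∀ i, E i) => f i (x i)) (iIndepFun_pi (μ := μ) fun i => (hf i).aemeasurable)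
    fun i => (hf i).comp (measurable_pi_apply i)
  rw [h]
  refine Finset.prod_congr rfl fun i _ => ?_
  rw [← (measurePreserving_eval μ i).lintegral_comp (hf i)]

theorem pi_withDensity {κ : Type*} [Fintype κ] {E : κ → Type*} [∀ i, MeasurableSpace (E i)]
    (μ : ∀ i, Measure (E i)) [∀ i, IsProbabilityMeasure (μ i)] {f : ∀ i, E i → ℝ≥0∞}
    (hf : ∀ i, Measurable (f i)) [∀ i, SigmaFinite ((μ i).withDensity (f i))] :
    Measure.pi (fun i => (μ i).withDensity (f i)) =
      (Measure.pi μ).withDensity fun x => ∏ i, f i (x i) := by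
  refine Measure.pi_eq fun s hs => ?_
  rw [withDensity_apply _ (MeasurableSet.univ_pi hs), ← lintegral_indicator
    (MeasurableSet.univ_pi hs)]
  have h : ∀ x : ∀ i, E i, (Set.univ.pi s).indicator (fun x => ∏ i, f i (x i)) x =
      ∏ i, (s i).indicator (f i) (x i) := by
    intro x
    by_cases hx : x ∈ Set.univ.pi s
    · rw [Set.indicator_of_mem hx]
      exact Finset.prod_congr rfl fun i _ => (Set.indicator_of_mem (hx i trivial) _).symm
    · rw [Set.indicator_of_notMem hx]
      simp only [Set.mem_pi, Set.mem_univ, forall_const, not_forall] at hx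
      obtain ⟨i, hi⟩ := hx
      exact (Finset.prod_eq_zero (Finset.mem_univ i) (Set.indicator_of_notMem hi _)).symm
  simp_rw [h]
  rw [lintegral_pi_prod μ fun i => (hf i).indicator (hs i)]
  refine Finset.prod_congr rfl fun i _ => ?_
  rw [lintegral_indicator (hs i), withDensity_apply _ (hs i)]

/-- One half of the Donsker-Varadhan formula, for measures with an exponential density. -/
theorem integral_add_integral_le_log_integral_exp {Ω : Type*} [MeasurableSpace Ω] {μ ν : Measure Ω}
    [IsProbabilityMeasure μ] [IsProbabilityMeasure ν] {l φ : Ω → ℝ} (hlm : Measurable l)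
    (hl : Integrable l μ) (hν : ν = μ.withDensity fun x => ENNReal.ofReal (Real.exp (l x)))
    (hφm : Measurable φ) {B : ℝ} (hφ : ∀ x, |φ x| ≤ B) :
    ∫ x, φ x ∂μ + ∫ x, l x ∂μ ≤ Real.log (∫ x, Real.exp (φ x) ∂ν) := by
  have hφi : Integrable φ μ := Integrable.of_bound hφm.aestronglyMeasurable B (ae_of_all _ hφ)
  have hei : Integrable (fun x => Real.exp (φ x)) ν :=
    Integrable.of_bound (by fun_prop) (Real.exp B) (ae_of_all _ fun x => by
      rw [Real.norm_eq_abs, Real.abs_exp]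
      exact Real.exp_le_exp.2 ((le_abs_self _).trans (hφ x)))
  have hmul : ∀ x, (ENNReal.ofReal (Real.exp (l x))).toReal • Real.exp (φ x) =
      Real.exp (φ x + l x) := fun x => by
    rw [ENNReal.toReal_ofReal (Real.exp_nonneg _), smul_eq_mul, ← Real.exp_add, add_comm]
  have hdm : Measurable fun x => ENNReal.ofReal (Real.exp (l x)) := by fun_prop
  have heq : ∫ x, Real.exp (φ x) ∂ν = ∫ x, Real.exp (φ x + l x) ∂μ := by
    rw [hν, integral_withDensity_eq_integral_toReal_smul hdm (ae_of_all _ fun x => by simp)]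
    simp_rw [hmul]
  have hi : Integrable (fun x => Real.exp (φ x + l x)) μ := by
    rw [hν, integrable_withDensity_iff_integrable_smul' hdm (ae_of_all _ fun x => by simp)] at hei
    simpa only [hmul] using hei
  rw [heq, ← integral_add hφi hl]
  set u := ∫ x, (φ x + l x) ∂μ with hu
  have hsum : Integrable (fun x => φ x + l x) μ := hφi.add hl
  -- Jensen's inequality for `exp`, from its tangent line at `u`.
  have key : Real.exp u ≤ ∫ x, Real.exp (φ x + l x) ∂μ := by
    have h1 : ∫ x, Real.exp u * (1 + ((φ x + l x) - u)) ∂μ = Real.exp u := by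
      rw [integral_const_mul, integral_add (g := fun x => φ x + l x - u)
        (integrable_const _) (hsum.sub (integrable_const _)), integral_sub hsum (integrable_const _)]
      simp [← hu]
    rw [← h1]
    refine integral_mono (((integrable_const _).add (hsum.sub (integrable_const _))).const_mul _) hi
      fun x => ?_
    have h2 := Real.add_one_le_exp (φ x + l x - u)
    calc Real.exp u * (1 + ((φ x + l x) - u)) ≤ Real.exp u * Real.exp (φ x + l x - u) := by
          gcongr; linarith
      _ = _ := by rw [← Real.exp_add, add_sub_cancel]
  rwa [Real.le_log_iff_exp_le ((Real.exp_pos u).trans_le key)]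

/-- The exponent is centred at `m`, so its linear part has mean zero under `𝒩(m, v)` and only `-(a -
m)² / (2v)` survives integration. -/
theorem gaussianReal_eq_withDensity (a m : ℝ) {v : ℝ≥0} (hv : v ≠ 0) :
    gaussianReal a v = (gaussianReal m v).withDensity
      fun x => ENNReal.ofReal (Real.exp ((a - m) * (x - m) / v - (a - m) ^ 2 / (2 * v))) := by
  rw [gaussianReal_of_var_ne_zero _ hv, gaussianReal_of_var_ne_zero _ hv,
    ← withDensity_mul _ (measurable_gaussianPDF m v) (by fun_prop)]
  congr 1
  ext x
  have hv' : (v : ℝ) ≠ 0 := by exact_mod_cast hv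
  rw [Pi.mul_apply, gaussianPDF, gaussianPDF, ← ENNReal.ofReal_mul (gaussianPDFReal_nonneg _ _ _),
    gaussianPDFReal, gaussianPDFReal, mul_assoc (√_)⁻¹, ← Real.exp_add]
  congr 3
  field_simp
  ring

theorem integral_le_log_integral_exp_pi_gaussianReal {κ : Type*} [Fintype κ] (m a : κ → ℝ)
    {v : ℝ≥0} (hv : v ≠ 0) {φ : (κ → ℝ) → ℝ} (hφm : Measurable φ) {B : ℝ} (hφ : ∀ x, |φ x| ≤ B) :
    ∫ x, φ x ∂(Measure.pi fun i => gaussianReal (m i) v) ≤ (∑ i, (m i - a i) ^ 2) / (2 * v) +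
      Real.log (∫ x, Real.exp (φ x) ∂(Measure.pi fun i => gaussianReal (a i) v)) := by
  set l : κ → ℝ → ℝ := fun i x =>
    (a i - m i) * (x - m i) / v - (a i - m i) ^ 2 / (2 * v) with hl
  have hlm : ∀ i, Measurable (l i) := fun i => by fun_prop
  have hidi : ∀ i, Integrable (fun x : ℝ => x) (gaussianReal (m i) v) := fun i =>
    memLp_one_iff_integrable.1 (memLp_id_gaussianReal 1)
  have hli : ∀ i, Integrable (l i) (gaussianReal (m i) v) := fun i =>
    ((((hidi i).sub (integrable_const _)).const_mul _).div_const _).sub (integrable_const _)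
  have hlint : ∀ i, ∫ x, l i x ∂(gaussianReal (m i) v) = -((m i - a i) ^ 2 / (2 * v)) := by
    intro i
    simp only [hl]
    rw [integral_sub (f := fun x => (a i - m i) * (x - m i) / v)
      ((((hidi i).sub (integrable_const _)).const_mul _).div_const _)
      (integrable_const _), integral_div, integral_const_mul,
      integral_sub (hidi i) (integrable_const _), integral_id_gaussianReal]
    simp only [integral_const, probReal_univ, one_smul, sub_self, mul_zero, zero_div, zero_sub]
    ring
  have hmp := fun i => measurePreserving_eval (fun i => gaussianReal (m i) v) i
  have hi : ∀ i, Integrable (fun x : κ → ℝ => l i (x i))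
      (Measure.pi fun i => gaussianReal (m i) v) := fun i =>
    (hmp i).integrable_comp_of_integrable (hli i)
  have hint : ∫ x : κ → ℝ, ∑ i, l i (x i) ∂(Measure.pi fun i => gaussianReal (m i) v) =
      -((∑ i, (m i - a i) ^ 2) / (2 * v)) := by
    rw [integral_finsetSum _ fun i _ => hi i, Finset.sum_div, ← Finset.sum_neg_distrib]
    refine Finset.sum_congr rfl fun i _ => ?_
    rw [← hlint i, ← (hmp i).map_eq, integral_map (hmp i).measurable.aemeasurable
      (hlm i).aestronglyMeasurable]
  have hd : (Measure.pi fun i => gaussianReal (a i) v) =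
      (Measure.pi fun i => gaussianReal (m i) v).withDensity
        fun x => ENNReal.ofReal (Real.exp (∑ i, l i (x i))) := by
    have he : ∀ i, gaussianReal (a i) v =
      (gaussianReal (m i) v).withDensity fun x => ENNReal.ofReal (Real.exp (l i x)) := fun i =>
        gaussianReal_eq_withDensity (a i) (m i) hv
    have : ∀ i, SigmaFinite
        ((gaussianReal (m i) v).withDensity fun x => ENNReal.ofReal (Real.exp (l i x))) := fun i => by
      rw [← he i]; infer_instance
    rw [show (fun i => gaussianReal (a i) v) = fun i => (gaussianReal (m i) v).withDensity
      fun x => ENNReal.ofReal (Real.exp (l i x)) from funext he, pi_withDensity _ fun i => by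
        have := hlm i; fun_prop]
    congr 1
    ext x
    rw [Real.exp_sum, ENNReal.ofReal_prod_of_nonneg fun i _ => Real.exp_nonneg _]
  have h := integral_add_integral_le_log_integral_exp
    (Finset.measurable_sum _ fun i _ => (hlm i).comp (measurable_pi_apply i))
    (integrable_finsetSum _ fun i _ => hi i) hd hφm hφ
  simp only [Function.comp_def] at h
  rw [hint] at h
  linarith

/-- Lévy's upward theorem: conditional expectations given the coordinates in finite sets exhausting
`ι` converge almost everywhere. -/
theorem exists_cylinder_approx {ι : Type*} [Countable ι] {E : ι → Type*}
    [∀ i, MeasurableSpace (E i)] (ν : Measure (∀ i, E i)) [IsFiniteMeasure ν]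
    {φ : (∀ i, E i) → ℝ} (hφm : Measurable φ) {B : ℝ} (hB : 0 ≤ B) (hφ : ∀ x, |φ x| ≤ B) :
    ∃ (S : ℕ → Finset ι) (h : ∀ k, (∀ i : S k, E i) → ℝ), (∀ k, Measurable (h k)) ∧
      (∀ k x, |h k x| ≤ B) ∧
      ∀ᵐ x ∂ν, Tendsto (fun k => h k ((S k).restrict x)) atTop (𝓝 (φ x)) := by
  obtain ⟨S, hSm, hSt⟩ := exists_seq_monotone_tendsto_atTop_atTop (Finset ι)
  let ℱ : Filtration ℕ (MeasurableSpace.pi (X := E)) :=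
    ⟨fun k => Filtration.piFinset (S k), fun i j hij => Filtration.piFinset.mono (hSm hij),
      fun k => Filtration.piFinset.le _⟩
  have hsup : MeasurableSpace.pi (X := E) ≤ ⨆ k, ℱ k := by
    refine iSup_le fun i => ?_
    obtain ⟨k, hk⟩ := (hSt.eventually (eventually_ge_atTop {i})).exists
    refine le_trans ?_ (le_iSup _ k)
    have hik : i ∈ S k := by simpa using hk
    have : (fun x : ∀ i, E i => x i) = (fun y : ∀ j : S k, E j => y ⟨i, hik⟩) ∘ (S k).restrict := rfl
    rw [this, ← MeasurableSpace.comap_comp]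
    exact MeasurableSpace.comap_mono
      (measurable_pi_apply (X := fun j : S k => E j) ⟨i, hik⟩).comap_le
  have hφi : Integrable φ ν := Integrable.of_bound hφm.aestronglyMeasurable B (ae_of_all _ hφ)
  have hconv := hφi.tendsto_ae_condExp (ℱ := ℱ) ((hφm.mono hsup le_rfl).stronglyMeasurable)
  have hfac : ∀ k, ∃ h : (∀ i : S k, E i) → ℝ, StronglyMeasurable h ∧
      ν[φ | ℱ k] = h ∘ (S k).restrict := fun k =>
    StronglyMeasurable.exists_eq_measurable_comp stronglyMeasurable_condExp
  choose h hm heq using hfac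
  -- Truncation turns an almost everywhere bound on the conditional expectation into an everywhere
  -- bound and leaves the limit unchanged.
  refine ⟨S, fun k x => max (-B) (min B (h k x)), fun k => ?_, fun k x => ?_, ?_⟩
  · have := (hm k).measurable
    fun_prop
  · exact abs_le.2 ⟨le_max_left _ _, max_le (by linarith) (min_le_left _ _)⟩
  · filter_upwards [hconv] with x hx
    have h1 : Tendsto (fun k => max (-B) (min B ((ν[φ | ℱ k]) x))) atTop
        (𝓝 (max (-B) (min B (φ x)))) := tendsto_const_nhds.max (tendsto_const_nhds.min hx)
    rw [min_eq_right (abs_le.1 (hφ x)).2, max_eq_right (abs_le.1 (hφ x)).1] at h1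
    refine h1.congr fun k => ?_
    rw [heq k]
    rfl

/-- The change of measure inequality for infinite products of Gaussians with the same variance. -/
theorem integral_le_log_integral_exp_infinitePi_gaussianReal {ι : Type*} [Countable ι]
    (m a : ι → ℝ) {v : ℝ≥0} (hv : v ≠ 0) {D : ℝ} (hD : ∀ s : Finset ι, ∑ i ∈ s, (m i - a i) ^ 2 ≤ D)
    {φ : (ι → ℝ) → ℝ} (hφm : Measurable φ) {B : ℝ} (hφ : ∀ x, |φ x| ≤ B) :
    ∫ x, φ x ∂(Measure.infinitePi fun i => gaussianReal (m i) v) ≤ D / (2 * v) +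
      Real.log (∫ x, Real.exp (φ x) ∂(Measure.infinitePi fun i => gaussianReal (a i) v)) := by
  set Q := Measure.infinitePi fun i => gaussianReal (m i) v with hQ
  set Q₀ := Measure.infinitePi fun i => gaussianReal (a i) v with hQ₀
  -- Working under `Q + Q₀` makes the same approximants converge almost everywhere for both
  -- measures, without a density between them.
  obtain ⟨S, h, hm, hB, hlim⟩ := exists_cylinder_approx (Q + Q₀) hφm
    ((abs_nonneg _).trans (hφ 0)) hφ
  rw [ae_add_measure_iff] at hlim
  have hexpb : ∀ {y : ℝ}, |y| ≤ B → ‖Real.exp y‖ ≤ Real.exp B := fun hy => by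
    rw [Real.norm_eq_abs, Real.abs_exp]
    exact Real.exp_le_exp.2 ((le_abs_self _).trans hy)
  have hmr : ∀ k, Measurable fun x : ι → ℝ => h k ((S k).restrict x) := fun k =>
    (hm k).comp (Finset.measurable_restrict _)
  have t1 : Tendsto (fun k => ∫ x, h k ((S k).restrict x) ∂Q) atTop (𝓝 (∫ x, φ x ∂Q)) :=
    tendsto_integral_of_dominated_convergence (fun _ => B)
      (fun k => (hmr k).aestronglyMeasurable) (integrable_const _)
      (fun k => ae_of_all _ fun x => hB k _) hlim.1
  have t2 : Tendsto (fun k => ∫ x, Real.exp (h k ((S k).restrict x)) ∂Q₀) atTop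
      (𝓝 (∫ x, Real.exp (φ x) ∂Q₀)) :=
    tendsto_integral_of_dominated_convergence (fun _ => Real.exp B)
      (fun k => (hmr k).exp.aestronglyMeasurable) (integrable_const _)
      (fun k => ae_of_all _ fun x => hexpb (hB k _))
      (hlim.2.mono fun x hx => (Real.continuous_exp.tendsto _).comp hx)
  have hpos : 0 < ∫ x, Real.exp (φ x) ∂Q₀ :=
    integral_exp_pos (Integrable.of_bound hφm.exp.aestronglyMeasurable (Real.exp B)
      (ae_of_all _ fun x => hexpb (hφ x)))
  refine le_of_tendsto_of_tendsto' t1 ((t2.log hpos.ne').const_add _) fun k => ?_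
  have e1 := integral_restrict_infinitePi (fun i => gaussianReal (m i) v) (s := S k)
    (hm k).aestronglyMeasurable
  have e2 := integral_restrict_infinitePi (fun i => gaussianReal (a i) v) (s := S k)
    (hm k).exp.aestronglyMeasurable
  rw [hQ, hQ₀, e1, e2]
  refine (integral_le_log_integral_exp_pi_gaussianReal _ (fun i : S k => a i) hv (hm k)
    (hB k)).trans ?_
  gcongr
  rw [Finset.sum_coe_sort (S k) fun i => (m i - a i) ^ 2]
  exact hD _

end ChangeOfMeasure

/-! ### Bernoulli likelihood ratios and their uniform mixture -/

section BernoulliDeviation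

/-- The likelihood ratio of Bernoulli distributions with parameters `q` and `p`, extended to
observations `x ∈ [0, 1]`. -/
noncomputable def bernoulliRatio (q p x : ℝ) : ℝ := (q / p) ^ x * ((1 - q) / (1 - p)) ^ (1 - x)

@[fun_prop]
theorem measurable_bernoulliRatio {α : Type*} [MeasurableSpace α] {q p x : α → ℝ}
    (hq : Measurable q) (hp : Measurable p) (hx : Measurable x) :
    Measurable fun a => bernoulliRatio (q a) (p a) (x a) := by
  unfold bernoulliRatio
  fun_prop

theorem bernoulliRatio_nonneg {q p x : ℝ} (hq : q ∈ Set.Icc (0 : ℝ) 1)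
    (hp : p ∈ Set.Icc (0 : ℝ) 1) : 0 ≤ bernoulliRatio q p x := by
  have := sub_nonneg.2 hq.2
  have := sub_nonneg.2 hp.2
  have := hq.1
  have := hp.1
  unfold bernoulliRatio
  positivity

/-- By weighted AM-GM the ratio lies below its linear interpolation between `x = 0` and `x = 1`,
whose mean is at most `q + (1 - q)`. -/
theorem lintegral_bernoulliRatio_le_one {Z : Type*} [MeasurableSpace Z] (P : Measure Z)
    [IsProbabilityMeasure P] {f : Z → ℝ} (hfm : Measurable f)
    (hf : ∀ z, f z ∈ Set.Icc (0 : ℝ) 1) {q : ℝ} (hq : q ∈ Set.Icc (0 : ℝ) 1) :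
    ∫⁻ z, ENNReal.ofReal (bernoulliRatio q (∫ z, f z ∂P) (f z)) ∂P ≤ 1 := by
  set p := ∫ z, f z ∂P with hp
  have hfi : Integrable f P := Integrable.of_mem_Icc 0 1 hfm.aemeasurable (ae_of_all _ hf)
  have hp0 : 0 ≤ p := integral_nonneg fun z => (hf z).1
  have hp1 : p ≤ 1 := by
    have := integral_mono hfi (integrable_const 1) fun z => (hf z).2
    simpa using this
  have hq1 := sub_nonneg.2 hq.2
  have hp1' := sub_nonneg.2 hp1
  have hq0 := hq.1
  have h1 : ∀ z, bernoulliRatio q p (f z) ≤ f z * (q / p) + (1 - f z) * ((1 - q) / (1 - p)) :=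
    fun z => Real.geom_mean_le_arith_mean2_weighted (hf z).1 (sub_nonneg.2 (hf z).2)
      (by positivity) (by positivity) (by ring)
  have hi1 : Integrable (fun z => f z * (q / p)) P := hfi.mul_const _
  have hi2 : Integrable (fun z => (1 - f z) * ((1 - q) / (1 - p))) P :=
    ((integrable_const 1).sub hfi).mul_const _
  refine (lintegral_mono fun z => ENNReal.ofReal_le_ofReal (h1 z)).trans ?_
  rw [← ofReal_integral_eq_lintegral_ofReal
    (f := fun z => f z * (q / p) + (1 - f z) * ((1 - q) / (1 - p))) (hi1.add hi2)
    (ae_of_all _ fun z => ?_)]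
  · rw [integral_add hi1 hi2, integral_mul_const, integral_mul_const,
      integral_sub (integrable_const 1) hfi, ← hp]
    simp only [integral_const, probReal_univ, one_smul]
    refine ENNReal.ofReal_le_one.2 ?_
    -- Only an inequality, since `q / 0 = 0` when `p = 0`.
    have e1 : p * (q / p) ≤ q := by
      rcases hp0.eq_or_lt with h | h
      · rw [← h]; simpa using hq0
      · exact (mul_div_cancel₀ q h.ne').le
    have e2 : (1 - p) * ((1 - q) / (1 - p)) ≤ 1 - q := by
      rcases hp1'.eq_or_lt with h | h
      · rw [← h]; simpa using hq.2
      · exact (mul_div_cancel₀ (1 - q) h.ne').le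
    linarith
  · have := (hf z).1
    have := sub_nonneg.2 (hf z).2
    simp only [Pi.zero_apply]
    positivity

/-- Ratios multiply along `q / u` and `u / p`, and a weighted geometric mean is at least the
minimum. -/
theorem bernoulliRatio_mul_min_le {u p x q : ℝ} (hu : u ∈ Set.Ioo (0 : ℝ) 1)
    (hp : p ∈ Set.Ioo (0 : ℝ) 1) (hx : x ∈ Set.Icc (0 : ℝ) 1) (hq : q ∈ Set.Icc (0 : ℝ) 1) :
    bernoulliRatio u p x * min (q / u) ((1 - q) / (1 - u)) ≤ bernoulliRatio q p x := by
  obtain ⟨hu0, hu1⟩ := hu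
  obtain ⟨hp0, hp1⟩ := hp
  obtain ⟨hx0, hx1⟩ := hx
  obtain ⟨hq0, hq1⟩ := hq
  have hu1' := sub_pos.2 hu1
  have hp1' := sub_pos.2 hp1
  have hx1' := sub_nonneg.2 hx1
  have hq1' := sub_nonneg.2 hq1
  have e1 : (q / p) ^ x = (u / p) ^ x * (q / u) ^ x := by
    rw [← Real.mul_rpow (by positivity) (by positivity)]
    congr 1
    field_simp
  have e2 : ((1 - q) / (1 - p)) ^ (1 - x) =
      ((1 - u) / (1 - p)) ^ (1 - x) * ((1 - q) / (1 - u)) ^ (1 - x) := by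
    rw [← Real.mul_rpow (by positivity) (by positivity)]
    congr 1
    field_simp
  have key : min (q / u) ((1 - q) / (1 - u)) ≤ (q / u) ^ x * ((1 - q) / (1 - u)) ^ (1 - x) := by
    rcases le_total q u with h | h
    · have h1 : q / u ≤ (q / u) ^ x :=
        Real.self_le_rpow_of_le_one (by positivity) ((div_le_one hu0).2 h) hx1
      have h2 : 1 ≤ ((1 - q) / (1 - u)) ^ (1 - x) :=
        Real.one_le_rpow ((one_le_div hu1').2 (by linarith)) hx1'
      calc _ ≤ q / u := min_le_left _ _
        _ ≤ (q / u) ^ x * 1 := by rwa [mul_one]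
        _ ≤ _ := by gcongr
    · have h1 : (1 - q) / (1 - u) ≤ ((1 - q) / (1 - u)) ^ (1 - x) :=
        Real.self_le_rpow_of_le_one (by positivity) ((div_le_one hu1').2 (by linarith))
          (by linarith)
      have h2 : 1 ≤ (q / u) ^ x := Real.one_le_rpow ((one_le_div hu0).2 h) hx0
      calc _ ≤ (1 - q) / (1 - u) := min_le_right _ _
        _ ≤ 1 * ((1 - q) / (1 - u)) ^ (1 - x) := by rwa [one_mul]
        _ ≤ _ := by gcongr
  unfold bernoulliRatio
  rw [e1, e2]
  calc _ ≤ (u / p) ^ x * ((1 - u) / (1 - p)) ^ (1 - x) *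
        ((q / u) ^ x * ((1 - q) / (1 - u)) ^ (1 - x)) := by gcongr
    _ = _ := by ring

/-- The minimum is a tent with peak `1` at `u`; its two sides contribute `u / (n + 1)` and `(1 - u)
/ (n + 1)`. -/
theorem integral_min_pow {u : ℝ} (hu : u ∈ Set.Ioo (0 : ℝ) 1) (n : ℕ) :
    ∫ q in (0 : ℝ)..1, (min (q / u) ((1 - q) / (1 - u))) ^ n = 1 / (n + 1) := by
  obtain ⟨hu0, hu1⟩ := hu
  have hu1' := sub_pos.2 hu1
  have hc : Continuous fun q : ℝ => (min (q / u) ((1 - q) / (1 - u))) ^ n := by fun_prop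
  rw [← intervalIntegral.integral_add_adjacent_intervals (hc.intervalIntegrable 0 u)
    (hc.intervalIntegrable u 1)]
  have h1 : ∫ q in (0 : ℝ)..u, (min (q / u) ((1 - q) / (1 - u))) ^ n =
      ∫ q in (0 : ℝ)..u, (q / u) ^ n := by
    refine intervalIntegral.integral_congr fun q hq => ?_
    rw [Set.uIcc_of_le hu0.le] at hq
    rw [min_eq_left]
    exact ((div_le_one hu0).2 hq.2).trans ((one_le_div hu1').2 (by linarith [hq.2]))
  have h2 : ∫ q in u..1, (min (q / u) ((1 - q) / (1 - u))) ^ n =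
      ∫ q in u..1, ((1 - q) / (1 - u)) ^ n := by
    refine intervalIntegral.integral_congr fun q hq => ?_
    rw [Set.uIcc_of_le hu1.le] at hq
    rw [min_eq_right]
    exact ((div_le_one hu1').2 (by linarith [hq.1])).trans ((one_le_div hu0).2 hq.1)
  rw [h1, h2, intervalIntegral.integral_comp_div (fun q => q ^ n) hu0.ne',
    intervalIntegral.integral_comp_sub_left (fun q => (q / (1 - u)) ^ n) 1,
    intervalIntegral.integral_comp_div (fun q => q ^ n) hu1'.ne']
  simp [hu0.ne', hu1'.ne', integral_pow]
  field_simp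
  ring

/-- The uniform mixture of the likelihood ratios `∏ᵢ bernoulliRatio q p (xᵢ)` over `q ∈ [0, 1]`,
multiplied by `n + 1`. For `p ∈ {0, 1}` it is `∞` except at the constant sample `xᵢ = p`. -/
noncomputable def bernoulliMixture {n : ℕ} (p : ℝ) (x : Fin n → ℝ) : ℝ≥0∞ :=
  open Classical in
  if p = 0 ∨ p = 1 then (if x = fun _ => p then 1 else ⊤)
  else (n + 1) * ∫⁻ q in Set.Icc (0 : ℝ) 1, ∏ i, ENNReal.ofReal (bernoulliRatio q p (x i))

theorem measurable_bernoulliMixture (n : ℕ) :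
    Measurable fun a : ℝ × (Fin n → ℝ) => bernoulliMixture a.1 a.2 := by
  unfold bernoulliMixture
  refine Measurable.ite ?_ (Measurable.ite ?_ measurable_const measurable_const) ?_
  · exact (measurableSet_eq_fun measurable_fst measurable_const).union
      (measurableSet_eq_fun measurable_fst measurable_const)
  · exact measurableSet_eq_fun measurable_snd (by fun_prop)
  · refine Measurable.const_mul ?_ _
    refine Measurable.lintegral_prod_right' (f := fun b : (ℝ × (Fin n → ℝ)) × ℝ =>
      ∏ i, ENNReal.ofReal (bernoulliRatio b.2 b.1.1 (b.1.2 i))) ?_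
    fun_prop

/-- The ratio at `q` is at least the ratio at `u` times the `n`-th power of the tent. Integrating
over `q` loses exactly the factor `n + 1` built into the mixture. -/
theorem prod_bernoulliRatio_le_bernoulliMixture {n : ℕ} {p u : ℝ} (hp : p ∈ Set.Ioo (0 : ℝ) 1)
    (hu : u ∈ Set.Ioo (0 : ℝ) 1) {x : Fin n → ℝ} (hx : ∀ i, x i ∈ Set.Icc (0 : ℝ) 1) :
    ENNReal.ofReal (∏ i, bernoulliRatio u p (x i)) ≤ bernoulliMixture p x := by
  have hpI := Set.Ioo_subset_Icc_self hp
  have huI := Set.Ioo_subset_Icc_self hu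
  unfold bernoulliMixture
  rw [if_neg (by rintro (h | h); exacts [hp.1.ne' h, hp.2.ne h])]
  set w : ℝ → ℝ := fun q => min (q / u) ((1 - q) / (1 - u)) with hw
  have hw0 : ∀ q ∈ Set.Icc (0 : ℝ) 1, 0 ≤ w q := fun q hq =>
    le_min (div_nonneg hq.1 huI.1) (div_nonneg (sub_nonneg.2 hq.2) (sub_nonneg.2 huI.2))
  have hwc : Continuous fun q => w q ^ n := by fun_prop
  have hr0 : 0 ≤ ∏ i, bernoulliRatio u p (x i) :=
    Finset.prod_nonneg fun i _ => bernoulliRatio_nonneg huI hpI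
  have hpt : ∀ q ∈ Set.Icc (0 : ℝ) 1, ENNReal.ofReal ((∏ i, bernoulliRatio u p (x i)) * w q ^ n) ≤
      ∏ i, ENNReal.ofReal (bernoulliRatio q p (x i)) := by
    intro q hq
    rw [← ENNReal.ofReal_prod_of_nonneg fun i _ => bernoulliRatio_nonneg hq hpI]
    refine ENNReal.ofReal_le_ofReal ?_
    have : w q ^ n = ∏ _i : Fin n, w q := by simp
    rw [this, ← Finset.prod_mul_distrib]
    exact Finset.prod_le_prod
      (fun i _ => mul_nonneg (bernoulliRatio_nonneg huI hpI) (hw0 q hq))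
      fun i _ => bernoulliRatio_mul_min_le hu hp (hx i) hq
  have hint : ∫⁻ q in Set.Icc (0 : ℝ) 1, ENNReal.ofReal ((∏ i, bernoulliRatio u p (x i)) * w q ^ n) =
      ENNReal.ofReal ((∏ i, bernoulliRatio u p (x i)) * (1 / (n + 1))) := by
    rw [← ofReal_integral_eq_lintegral_ofReal]
    · rw [integral_const_mul, integral_Icc_eq_integral_Ioc,
        ← intervalIntegral.integral_of_le zero_le_one, integral_min_pow hu n]
    · exact (hwc.const_mul _).integrableOn_Icc
    · filter_upwards [ae_restrict_mem measurableSet_Icc] with q hq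
      exact mul_nonneg hr0 (pow_nonneg (hw0 q hq) n)
  have hmono := setLIntegral_mono' measurableSet_Icc hpt (μ := volume)
  rw [hint] at hmono
  refine le_trans (le_of_eq ?_) (mul_le_mul_right hmono _)
  rw [show ((n : ℝ≥0∞) + 1) = ENNReal.ofReal (n + 1) by
    rw [ENNReal.ofReal_add (by positivity) zero_le_one]; simp,
    ← ENNReal.ofReal_mul (by positivity)]
  congr 1
  field_simp

theorem one_sub_add_mul_exp_pos {p : ℝ} (hp : p ∈ Set.Icc (0 : ℝ) 1) (t : ℝ) :
    0 < 1 - p + p * Real.exp t := by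
  have := Real.exp_pos t
  rcases hp.1.eq_or_lt with h | h
  · rw [← h]; norm_num
  · have := sub_nonneg.2 hp.2
    positivity

/-- Exponential tilting: with `u = p eᵗ / (1 - p + p eᵗ)` the likelihood ratio is this exponential.
The right-hand side is free of `t`, so one event will serve all `t`. -/
theorem exp_le_bernoulliMixture {n : ℕ} {p : ℝ} (hp : p ∈ Set.Icc (0 : ℝ) 1)
    {x : Fin n → ℝ} (hx : ∀ i, x i ∈ Set.Icc (0 : ℝ) 1) (t : ℝ) :
    ENNReal.ofReal (Real.exp (t * ∑ i, x i - n * Real.log (1 - p + p * Real.exp t))) ≤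
      bernoulliMixture p x := by
  by_cases hd : p = 0 ∨ p = 1
  · unfold bernoulliMixture
    rw [if_pos hd]
    split_ifs with h
    · rcases hd with rfl | rfl
      · simp [h]
      · simp [h, mul_comm]
    · exact le_top
  · rw [not_or] at hd
    have hp' : p ∈ Set.Ioo (0 : ℝ) 1 := ⟨hp.1.lt_of_ne' hd.1, hp.2.lt_of_ne hd.2⟩
    have hD := one_sub_add_mul_exp_pos hp t
    set D := 1 - p + p * Real.exp t with hDdef
    have hp1 := sub_pos.2 hp'.2
    have hp0 := hp'.1
    have he := Real.exp_pos t
    have hu : p * Real.exp t / D ∈ Set.Ioo (0 : ℝ) 1 := by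
      refine ⟨by positivity, ?_⟩
      rw [div_lt_one hD]
      linarith
    refine le_of_eq_of_le ?_ (prod_bernoulliRatio_le_bernoulliMixture hp' hu hx)
    congr 1
    have hr : ∀ i, bernoulliRatio (p * Real.exp t / D) p (x i) =
        Real.exp (t * x i - Real.log D) := by
      intro i
      have h1 : p * Real.exp t / D / p = Real.exp t * D⁻¹ := by field_simp
      have h2 : (1 - p * Real.exp t / D) / (1 - p) = D⁻¹ := by
        rw [one_sub_div hD.ne', hDdef]
        field_simp
        ring
      unfold bernoulliRatio
      rw [h1, h2, Real.mul_rpow he.le (by positivity), mul_assoc,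
        ← Real.rpow_add (by positivity), add_sub_cancel, Real.rpow_one, ← Real.exp_mul,
        Real.exp_sub, Real.exp_log hD, div_eq_mul_inv]
    simp_rw [hr]
    rw [← Real.exp_sum, Finset.sum_sub_distrib, Finset.mul_sum]
    simp

/-- After swapping integrals, independence factorizes each product into means at most `1`. For `p ∈
{0, 1}` the losses equal `p` almost surely, so the value `∞` is harmless. -/
theorem lintegral_bernoulliMixture_le {Z : Type*} [MeasurableSpace Z] (P : Measure Z)
    [IsProbabilityMeasure P] {f : Z → ℝ} (hfm : Measurable f)
    (hf : ∀ z, f z ∈ Set.Icc (0 : ℝ) 1) (n : ℕ) :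
    ∫⁻ s, bernoulliMixture (∫ z, f z ∂P) (fun i => f (s i)) ∂(Measure.pi fun _ : Fin n => P) ≤
      n + 1 := by
  set p := ∫ z, f z ∂P with hp
  have hfi : Integrable f P := Integrable.of_mem_Icc 0 1 hfm.aemeasurable (ae_of_all _ hf)
  unfold bernoulliMixture
  split_ifs with hd
  · have hae : ∀ᵐ z ∂P, f z = p := by
      rcases hd with h | h
      · rw [h]
        exact (integral_eq_zero_iff_of_nonneg (fun z => (hf z).1) hfi).1 (hp.symm.trans h)
      · rw [h]
        have h2 : ∫ z, (1 - f z) ∂P = 0 := by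
          rw [integral_sub (integrable_const 1) hfi, ← hp, h]; simp
        have h3 := (integral_eq_zero_iff_of_nonneg (fun z => sub_nonneg.2 (hf z).2)
          ((integrable_const 1).sub hfi)).1 h2
        filter_upwards [h3] with z hz
        simp only [Pi.zero_apply] at hz
        linarith
    have hall : ∀ᵐ s ∂(Measure.pi fun _ : Fin n => P), ∀ i, f (s i) = p :=
      ae_all_iff.2 fun i => (measurePreserving_eval (fun _ : Fin n => P) i).quasiMeasurePreserving.ae
        hae
    have h1 : ∫⁻ s, (open Classical in if (fun i => f (s i)) = fun _ => p then (1 : ℝ≥0∞) else ⊤)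
        ∂(Measure.pi fun _ : Fin n => P) = ∫⁻ _, 1 ∂(Measure.pi fun _ : Fin n => P) :=
      lintegral_congr_ae (hall.mono fun s hs => if_pos (funext hs))
    rw [h1]
    simp
  · rw [lintegral_const_mul _ (by
      refine Measurable.lintegral_prod_right' (f := fun b : (Fin n → Z) × ℝ =>
        ∏ i, ENNReal.ofReal (bernoulliRatio b.2 p (f (b.1 i)))) ?_
      fun_prop),
      lintegral_lintegral_swap (Measurable.aemeasurable (by unfold Function.uncurry; fun_prop))]
    refine (mul_le_mul_right (setLIntegral_mono' measurableSet_Icc (g := fun _ => 1)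
      fun q hq => ?_) _).trans (by simp)
    rw [lintegral_pi_prod (fun _ : Fin n => P)
      (f := fun _ z => ENNReal.ofReal (bernoulliRatio q p (f z))) fun i => by fun_prop]
    exact Finset.prod_le_one' fun i _ => lintegral_bernoulliRatio_le_one P hfm hf hq

/-- The Bernoulli divergence is the Legendre transform of `t ↦ log(1 - q₀ + q₀ eᵗ)`; the boundary
cases need `t → -∞`. -/
theorem klPlus_le_of_forall {q q₀ B : ℝ} (hq : q ∈ Set.Icc (0 : ℝ) 1)
    (hq₀ : q₀ ∈ Set.Icc (0 : ℝ) 1) (hB : 0 ≤ B)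
    (h : ∀ t : ℝ, t * q - Real.log (1 - q₀ + q₀ * Real.exp t) ≤ B) : klPlus q q₀ ≤ (B : EReal) := by
  unfold klPlus
  split_ifs with hlt
  swap
  · exact_mod_cast hB
  have hq₀0 : 0 < q₀ := hq.1.trans_lt hlt
  rcases hq₀.2.eq_or_lt with rfl | hq₀1
  · have h1 := h (-((B + 1) / (1 - q)))
    have h2 : 0 < 1 - q := sub_pos.2 hlt
    simp only [sub_self, zero_add, one_mul, Real.log_exp] at h1
    have h3 : -((B + 1) / (1 - q)) * q - -((B + 1) / (1 - q)) = B + 1 := by field_simp; ring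
    linarith
  have hq1 : 0 < 1 - q := by linarith
  have hq₀1' : 0 < 1 - q₀ := by linarith
  unfold klBernoulli klTerm
  rw [if_neg hq1.ne', if_neg hq₀1'.ne', if_neg hq₀0.ne']
  rcases hq.1.eq_or_lt with rfl | hq0
  · rw [if_pos rfl, zero_add]
    have hlim : Filter.Tendsto (fun t : ℝ => t * 0 - Real.log (1 - q₀ + q₀ * Real.exp t))
        Filter.atBot (nhds (0 - Real.log (1 - q₀ + q₀ * 0))) := by
      simp only [mul_zero]
      refine Filter.Tendsto.const_sub _ (Filter.Tendsto.log ?_ (by simpa using hq₀1'.ne'))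
      have := (Real.tendsto_exp_atBot.const_mul q₀).const_add (1 - q₀)
      simpa using this
    have := le_of_tendsto' hlim h
    rw [sub_zero, one_mul, one_div, Real.log_inv]
    simp only [mul_zero, add_zero, zero_sub] at this
    exact_mod_cast this
  · rw [if_neg hq0.ne', ← EReal.coe_add, EReal.coe_le_coe_iff]
    -- The maximizer in `t` is the log odds ratio.
    have h1 := h (Real.log (q / q₀) - Real.log ((1 - q) / (1 - q₀)))
    rw [Real.exp_sub, Real.exp_log (by positivity), Real.exp_log (by positivity)] at h1
    have h2 : 1 - q₀ + q₀ * (q / q₀ / ((1 - q) / (1 - q₀))) = ((1 - q) / (1 - q₀))⁻¹ := by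
      field_simp
      ring
    rw [h2, Real.log_inv] at h1
    linarith

end BernoulliDeviation

/-! ### The PAC-Bayes argument for a general prior -/

section PACBayes

theorem integral_mem_Icc {Ω : Type*} [MeasurableSpace Ω] {μ : Measure Ω} [IsProbabilityMeasure μ]
    {f : Ω → ℝ} {a b : ℝ} (hfm : AEMeasurable f μ) (hf : ∀ x, f x ∈ Set.Icc a b) :
    ∫ x, f x ∂μ ∈ Set.Icc a b := by
  have hfi : Integrable f μ := Integrable.of_mem_Icc a b hfm (ae_of_all _ hf)
  have h1 := integral_mono (integrable_const a) hfi fun x => (hf x).1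
  have h2 := integral_mono hfi (integrable_const b) fun x => (hf x).2
  simp only [integral_const, probReal_univ, one_smul] at h1 h2
  exact ⟨h1, h2⟩

theorem integral_log_le_log_integral {Ω : Type*} [MeasurableSpace Ω] {μ : Measure Ω}
    [IsProbabilityMeasure μ] {D : Ω → ℝ} (hD : ∀ x, 0 < D x) (hDi : Integrable D μ)
    (hlog : Integrable (fun x => Real.log (D x)) μ) :
    ∫ x, Real.log (D x) ∂μ ≤ Real.log (∫ x, D x ∂μ) := by
  set m := ∫ x, D x ∂μ with hm
  have hmpos : 0 < m := by
    refine (integral_pos_iff_support_of_nonneg (fun x => (hD x).le) hDi).2 ?_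
    rw [show Function.support D = Set.univ from Set.eq_univ_of_forall fun x => (hD x).ne']
    simp
  have h : ∀ x, Real.log (D x) ≤ Real.log m + (D x / m - 1) := fun x => by
    have := Real.log_le_sub_one_of_pos (div_pos (hD x) hmpos)
    rw [Real.log_div (hD x).ne' hmpos.ne'] at this
    linarith
  have hi : Integrable (fun x => D x / m - 1) μ := (hDi.div_const m).sub (integrable_const 1)
  refine (integral_mono hlog ((integrable_const _).add hi) h).trans (le_of_eq ?_)
  simp only [Pi.add_apply]
  rw [integral_add (integrable_const _) hi, integral_sub (hDi.div_const m) (integrable_const 1),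
    integral_div, ← hm, div_self hmpos.ne']
  simp

theorem abs_log_one_sub_add_mul_exp_le {p : ℝ} (hp : p ∈ Set.Icc (0 : ℝ) 1) (t : ℝ) :
    |Real.log (1 - p + p * Real.exp t)| ≤ |t| := by
  have hD := one_sub_add_mul_exp_pos hp t
  have hp1 := sub_nonneg.2 hp.2
  rw [abs_le]
  constructor
  · rw [Real.le_log_iff_exp_le hD]
    have h1 : Real.exp (-|t|) ≤ 1 := Real.exp_le_one_iff.2 (by simp)
    have h2 : Real.exp (-|t|) ≤ Real.exp t := Real.exp_le_exp.2 (neg_abs_le t)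
    nlinarith [hp.1]
  · rw [Real.log_le_iff_le_exp hD]
    have h1 : 1 ≤ Real.exp |t| := Real.one_le_exp (abs_nonneg t)
    have h2 : Real.exp t ≤ Real.exp |t| := Real.exp_le_exp.2 (le_abs_self t)
    nlinarith [hp.1]

variable {C Z : Type*} [MeasurableSpace C] [MeasurableSpace Z]

/-- The PAC-Bayes inequality for a fixed sample, given the change of measure inequality. -/
theorem klPlus_le_of_changeOfMeasure {n : ℕ} (hn : 1 ≤ n) (P : Measure Z) [IsProbabilityMeasure P]
    {g : C → Z → ℝ} (hgm : Measurable (Function.uncurry g))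
    (hg : ∀ c z, g c z ∈ Set.Icc (0 : ℝ) 1) (Q Q₀ : Measure C) [IsProbabilityMeasure Q]
    [IsProbabilityMeasure Q₀] {K M : ℝ} (hK : 0 ≤ K) (hM : 1 ≤ M)
    (hQ : ∀ (φ : C → ℝ) (B : ℝ), Measurable φ → (∀ c, |φ c| ≤ B) →
      ∫ c, φ c ∂Q ≤ K + Real.log (∫ c, Real.exp (φ c) ∂Q₀)) (s : Fin n → Z)
    (hs : ∫⁻ c, bernoulliMixture (∫ z, g c z ∂P) (fun i => g c (s i)) ∂Q₀ ≤ ENNReal.ofReal M) :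
    klPlus (∫ c, (∑ i, g c (s i)) / n ∂Q) (∫ c, ∫ z, g c z ∂P ∂Q) ≤
      (((K + Real.log M) / n : ℝ) : EReal) := by
  have hn0 : (0 : ℝ) < n := by exact_mod_cast hn
  set p : C → ℝ := fun c => ∫ z, g c z ∂P with hp
  have hpm : Measurable p := hgm.stronglyMeasurable.integral_prod_right.measurable
  have hgc : ∀ c, Measurable (g c) := fun c => hgm.comp measurable_prodMk_left
  have hgz : ∀ z, Measurable fun c => g c z := fun z => hgm.comp measurable_prodMk_right
  have hpI : ∀ c, p c ∈ Set.Icc (0 : ℝ) 1 := fun c => integral_mem_Icc (hgc c).aemeasurable (hg c)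
  have ham : Measurable fun c => ∑ i, g c (s i) := Finset.measurable_sum _ fun i _ => hgz (s i)
  have ha0 : ∀ c, 0 ≤ ∑ i, g c (s i) := fun c => Finset.sum_nonneg fun i _ => (hg c _).1
  have han : ∀ c, ∑ i, g c (s i) ≤ n := fun c => by
    simpa using Finset.sum_le_sum fun i (_ : i ∈ Finset.univ) => (hg c (s i)).2
  have hqI : ∀ c, (∑ i, g c (s i)) / n ∈ Set.Icc (0 : ℝ) 1 := fun c =>
    ⟨div_nonneg (ha0 c) hn0.le, (div_le_one hn0).2 (han c)⟩
  have hqm : Measurable fun c => (∑ i, g c (s i)) / n := ham.div_const _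
  refine klPlus_le_of_forall (integral_mem_Icc hqm.aemeasurable hqI)
    (integral_mem_Icc hpm.aemeasurable hpI)
    (div_nonneg (add_nonneg hK (Real.log_nonneg hM)) hn0.le) fun t => ?_
  have hDpos : ∀ c, 0 < 1 - p c + p c * Real.exp t := fun c => one_sub_add_mul_exp_pos (hpI c) t
  have hDm : Measurable fun c => 1 - p c + p c * Real.exp t := by fun_prop
  have hLb : ∀ c, |Real.log (1 - p c + p c * Real.exp t)| ≤ |t| := fun c =>
    abs_log_one_sub_add_mul_exp_le (hpI c) t
  have hpi : Integrable p Q := Integrable.of_mem_Icc 0 1 hpm.aemeasurable (ae_of_all _ hpI)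
  have hDi : Integrable (fun c => 1 - p c + p c * Real.exp t) Q :=
    ((integrable_const 1).sub hpi).add (hpi.mul_const _)
  have hLi : Integrable (fun c => Real.log (1 - p c + p c * Real.exp t)) Q :=
    Integrable.of_bound hDm.log.aestronglyMeasurable |t| (ae_of_all _ hLb)
  have hqi : Integrable (fun c => (∑ i, g c (s i)) / n) Q :=
    Integrable.of_mem_Icc 0 1 hqm.aemeasurable (ae_of_all _ hqI)
  set φ : C → ℝ := fun c =>
    t * ∑ i, g c (s i) - n * Real.log (1 - p c + p c * Real.exp t) with hφ
  have hφm : Measurable φ := by fun_prop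
  have hφb : ∀ c, |φ c| ≤ |t| * n + n * |t| := fun c => by
    refine (abs_sub _ _).trans ?_
    rw [abs_mul, abs_mul, abs_of_nonneg (ha0 c), abs_of_nonneg hn0.le]
    exact add_le_add (mul_le_mul_of_nonneg_left (han c) (abs_nonneg t))
      (mul_le_mul_of_nonneg_left (hLb c) hn0.le)
  have hexp : ∫ c, Real.exp (φ c) ∂Q₀ ≤ M := by
    rw [integral_eq_lintegral_of_nonneg_ae (ae_of_all _ fun c => Real.exp_nonneg _)
      hφm.exp.aestronglyMeasurable]
    refine ENNReal.toReal_le_of_le_ofReal (by linarith) (le_trans (lintegral_mono fun c => ?_) hs)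
    exact exp_le_bernoulliMixture (hpI c) (fun i => hg c (s i)) t
  have hexp_pos : 0 < ∫ c, Real.exp (φ c) ∂Q₀ :=
    integral_exp_pos (Integrable.of_bound hφm.exp.aestronglyMeasurable
      (Real.exp (|t| * n + n * |t|)) (ae_of_all _ fun c => by
        rw [Real.norm_eq_abs, Real.abs_exp]
        exact Real.exp_le_exp.2 ((le_abs_self _).trans (hφb c))))
  have h1 := (hQ φ _ hφm hφb).trans (add_le_add_right (Real.log_le_log hexp_pos hexp) K)
  have h2 : ∫ c, φ c ∂Q = n * (t * ∫ c, (∑ i, g c (s i)) / n ∂Q -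
      ∫ c, Real.log (1 - p c + p c * Real.exp t) ∂Q) := by
    rw [← integral_const_mul, ← integral_sub (hqi.const_mul t) hLi, ← integral_const_mul]
    refine integral_congr_ae (ae_of_all _ fun c => ?_)
    simp only [hφ]
    field_simp
  -- Concavity of `log` replaces the average of the log moment generating functions by the one at
  -- the averaged risk.
  have h3 := integral_log_le_log_integral hDpos hDi hLi
  have h4 : ∫ c, (1 - p c + p c * Real.exp t) ∂Q = 1 - ∫ c, p c ∂Q + (∫ c, p c ∂Q) * Real.exp t := by
    rw [integral_add (f := fun c => 1 - p c) ((integrable_const 1).sub hpi) (hpi.mul_const _),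
      integral_sub (integrable_const 1) hpi, integral_mul_const]
    simp
  rw [h4] at h3
  rw [h2] at h1
  rw [le_div_iff₀ hn0, mul_comm]
  refine le_trans (mul_le_mul_of_nonneg_left ?_ hn0.le) h1
  linarith

/-- `Q₀` does not depend on the sample, so Tonelli bounds the expectation by `n + 1`, and Markov's
inequality applies. -/
theorem measure_lintegral_bernoulliMixture_gt_le {n : ℕ} (P : Measure Z) [IsProbabilityMeasure P]
    {g : C → Z → ℝ} (hgm : Measurable (Function.uncurry g))
    (hg : ∀ c z, g c z ∈ Set.Icc (0 : ℝ) 1) (Q₀ : Measure C) [IsProbabilityMeasure Q₀] {δ : ℝ}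
    (hδ : 0 < δ) :
    (Measure.pi fun _ : Fin n => P) {s | ENNReal.ofReal ((n + 1) / δ) <
      ∫⁻ c, bernoulliMixture (∫ z, g c z ∂P) (fun i => g c (s i)) ∂Q₀} ≤ ENNReal.ofReal δ := by
  have hgc : ∀ c, Measurable (g c) := fun c => hgm.comp measurable_prodMk_left
  have hpm : Measurable fun c => ∫ z, g c z ∂P :=
    hgm.stronglyMeasurable.integral_prod_right.measurable
  have hjm : Measurable fun a : (Fin n → Z) × C =>
      bernoulliMixture (∫ z, g a.2 z ∂P) (fun i => g a.2 (a.1 i)) := by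
    refine (measurable_bernoulliMixture n).comp ((hpm.comp measurable_snd).prodMk
      (measurable_pi_lambda _ fun i => ?_))
    exact hgm.comp (measurable_snd.prodMk ((measurable_pi_apply i).comp measurable_fst))
  have hM : 0 < ((n : ℝ) + 1) / δ := by positivity
  have hle : ∫⁻ s, ∫⁻ c, bernoulliMixture (∫ z, g c z ∂P) (fun i => g c (s i)) ∂Q₀
      ∂(Measure.pi fun _ : Fin n => P) ≤ n + 1 := by
    rw [lintegral_lintegral_swap hjm.aemeasurable]
    refine (lintegral_mono fun c => lintegral_bernoulliMixture_le P (hgc c) (hg c) n).trans ?_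
    simp
  have hmarkov := meas_ge_le_lintegral_div (μ := Measure.pi fun _ : Fin n => P)
    (hjm.lintegral_prod_right' (ν := Q₀)).aemeasurable
    (ε := ENNReal.ofReal ((n + 1) / δ)) (by simpa using hM) ENNReal.ofReal_ne_top
  refine (measure_mono fun s hs => ?_).trans (hmarkov.trans
    ((ENNReal.div_le_div_right hle _).trans (le_of_eq ?_)))
  · exact (Set.mem_ofPred_eq ▸ hs : _ < _).le
  · rw [show ((n : ℝ≥0∞) + 1) = ENNReal.ofReal (n + 1) by
      rw [ENNReal.ofReal_add (by positivity) zero_le_one]; simp,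
      ← ENNReal.ofReal_div_of_pos hM]
    congr 1
    field_simp

end PACBayes

/-! ### Gaussians on the Hilbert space -/

section Gaussian

/-- Basis vectors are at distance `√2`, so their balls of radius `1/2` are disjoint open sets in a
separable space. -/
theorem countable_index_of_hilbertBasis {ι H : Type*} [NormedAddCommGroup H]
    [InnerProductSpace ℝ H] [TopologicalSpace.SeparableSpace H] (b : HilbertBasis ι ℝ H) :
    Countable ι := by
  have hd : Pairwise (Function.onFun Disjoint fun i => Metric.ball (b i) (1 / 2)) := by
    intro i j hij
    refine Metric.ball_disjoint_ball ?_
    have h1 : dist (b i) (b j) ^ 2 = 2 := by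
      rw [dist_eq_norm, norm_sub_sq_real, b.orthonormal.1, b.orthonormal.1, b.orthonormal.2 hij]
      norm_num
    nlinarith [dist_nonneg (x := b i) (y := b j)]
  exact hd.countable_of_isOpen_disjoint (fun i => Metric.isOpen_ball)
    fun i => Metric.nonempty_ball.2 (by norm_num)

instance {ι H : Type*} [NormedAddCommGroup H] [InnerProductSpace ℝ H] (b : HilbertBasis ι ℝ H)
    (m : H) (v : ℝ≥0) : IsProbabilityMeasure (gaussian b m v) := by
  unfold gaussian
  infer_instance

/-- Bessel's inequality bounds every finite sum of squared coordinate differences by `‖m - a‖²`. -/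
theorem integral_le_log_integral_exp_gaussian {ι H : Type*} [NormedAddCommGroup H]
    [InnerProductSpace ℝ H] [TopologicalSpace.SeparableSpace H]
    (b : HilbertBasis ι ℝ H) (m a : H) {v : ℝ≥0} (hv : v ≠ 0) (φ : (ι → ℝ) → ℝ) (B : ℝ)
    (hφm : Measurable φ) (hφ : ∀ x, |φ x| ≤ B) :
    ∫ x, φ x ∂(gaussian b m v) ≤ ‖m - a‖ ^ 2 / (2 * v) +
      Real.log (∫ x, Real.exp (φ x) ∂(gaussian b a v)) := by
  have := countable_index_of_hilbertBasis b
  refine integral_le_log_integral_exp_infinitePi_gaussianReal _ _ hv (fun s => ?_) hφm hφ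
  have h := b.orthonormal.sum_inner_products_le (s := s) (m - a)
  refine le_trans (le_of_eq (Finset.sum_congr rfl fun i _ => ?_)) h
  rw [← b.repr_apply_apply, map_sub, Real.norm_eq_abs, sq_abs]
  rfl

end Gaussian

/-! ### Empirical risk and sensitivity -/

section Risk

theorem risk_empiricalMeasure {X Y T : Type*} [MeasurableSpace X] [MeasurableSpace Y]
    (loss : T → Y → ℝ) (h : X → T) (hm : Measurable fun z : X × Y => loss (h z.1) z.2) {n : ℕ}
    (s : Fin n → X × Y) :
    risk loss h (empiricalMeasure s) = (∑ i, loss (h (s i).1) (s i).2) / n := by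
  unfold risk empiricalMeasure
  rw [integral_smul_measure, integral_finsetSum_measure fun i _ =>
    integrable_dirac' hm.stronglyMeasurable (by simp)]
  simp_rw [integral_dirac' _ _ hm.stronglyMeasurable]
  simp [div_eq_inv_mul]

end Risk

theorem norm_sub_update_le_toReal_sensitivity {Z H : Type*} [NormedAddCommGroup H]
    {A : (n : ℕ) → (Fin n → Z) → H} {n : ℕ} (h : sensitivity A n ≠ ⊤) (i : Fin n) (z : Fin n → Z)
    (z' : Z) : ‖A n z - A n (Function.update z i z')‖ ≤ (sensitivity A n).toReal := by
  rw [← toReal_enorm]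
  refine ENNReal.toReal_mono h ?_
  exact le_iSup_of_le i (le_iSup_of_le z (le_iSup_of_le z' le_rfl))

end StablePACBayes

/-! ### Assembly: stability and PAC-Bayes combined -/

theorem mainTheorem1
    {X Y T ι H : Type*} [MeasurableSpace X] [MeasurableSpace Y] [MeasurableSpace T]
    [NormedAddCommGroup H] [InnerProductSpace ℝ H] [CompleteSpace H]
    [TopologicalSpace.SeparableSpace H] [MeasurableSpace H] [BorelSpace H]
    (b : HilbertBasis ι ℝ H)
    (loss : T → Y → ℝ) (hloss : Measurable (Function.uncurry loss))
    (hloss01 : ∀ t y, loss t y ∈ Set.Icc (0 : ℝ) 1)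
    (pred : (ι → ℝ) → X → T) (hpred : Measurable (Function.uncurry pred))
    (A : (n : ℕ) → (Fin n → X × Y) → H) (hA : ∀ n, Measurable (A n))
    (P : Measure (X × Y)) [IsProbabilityMeasure P]
    (n : ℕ) (hn : 1 ≤ n) (σ : ℝ≥0) (hσ : 0 < σ) (δ : ℝ) (hδ : δ ∈ Set.Ioo (0 : ℝ) 1) :
    ENNReal.ofReal (1 - 2 * δ) ≤
      (Measure.pi fun _ : Fin n => P)
        {s | StablePACBayes.klPlus
              (StablePACBayes.avgRisk loss pred (StablePACBayes.gaussian b (A n s) (σ ^ 2))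
                (StablePACBayes.empiricalMeasure s))
              (StablePACBayes.avgRisk loss pred (StablePACBayes.gaussian b (A n s) (σ ^ 2)) P) ≤
            (((n * StablePACBayes.sensitivity A n ^ 2 / (2 * (σ : ℝ≥0∞) ^ 2) *
                  ENNReal.ofReal ((1 + √(1 / 2 * Real.log (1 / δ))) ^ 2) +
                ENNReal.ofReal (Real.log ((n + 1) / δ))) / n : ℝ≥0∞) : EReal)} := by
  open StablePACBayes in
  have hn0 : (0 : ℝ) < n := by exact_mod_cast hn
  have hnn : (n : ℝ≥0∞) ≠ 0 := by simp; omega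
  set L := 1 + √(1 / 2 * Real.log (1 / δ)) with hL
  have hLpos : 0 < L := by positivity
  have hδ0 := hδ.1
  have hM : (1 : ℝ) ≤ (n + 1) / δ := by
    rw [le_div_iff₀ hδ.1]
    linarith [hδ.2]
  -- Infinite sensitivity makes the right-hand side `⊤`, so the event is everything.
  by_cases htop : sensitivity A n = ⊤
  · have hσ0 : (σ : ℝ≥0∞) ≠ 0 := by simpa using hσ.ne'
    have hL2 : ENNReal.ofReal (L ^ 2) ≠ 0 := by simp; positivity
    have h1 : ((n * sensitivity A n ^ 2 / (2 * (σ : ℝ≥0∞) ^ 2) * ENNReal.ofReal (L ^ 2) +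
        ENNReal.ofReal (Real.log ((n + 1) / δ))) / n : ℝ≥0∞) = ⊤ := by
      rw [htop, ENNReal.top_pow two_ne_zero, ENNReal.mul_top hnn, ENNReal.top_div_of_ne_top
        (by finiteness), ENNReal.top_mul hL2, top_add, ENNReal.top_div_of_ne_top (by simp)]
    simp only [h1, EReal.coe_ennreal_top, le_top, Set.ofPred_true, measure_univ]
    exact ENNReal.ofReal_le_one.2 (by linarith)
  set β := (sensitivity A n).toReal with hβ
  have hAs : StronglyMeasurable (A n) := (hA n).stronglyMeasurable
  have hdiff := norm_sub_update_le_toReal_sensitivity htop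
  set μ := Measure.pi fun _ : Fin n => P with hμ
  set m := ∫ s, A n s ∂μ with hm
  set g : (ι → ℝ) → X × Y → ℝ := fun c z => loss (pred c z.1) z.2 with hg
  have hgm : Measurable (Function.uncurry g) := by
    have h1 : Measurable fun a : (ι → ℝ) × (X × Y) => pred a.1 a.2.1 :=
      hpred.comp (measurable_fst.prodMk (measurable_fst.comp measurable_snd))
    exact hloss.comp (h1.prodMk (measurable_snd.comp measurable_snd))
  have hgI : ∀ c z, g c z ∈ Set.Icc (0 : ℝ) 1 := fun c z => hloss01 _ _
  have hgc : ∀ c, Measurable (g c) := fun c => hgm.comp measurable_prodMk_left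
  have hv : σ ^ 2 ≠ 0 := by positivity
  have hbad1 := measure_norm_sub_integral_gt_le P ENNReal.toReal_nonneg hAs hdiff hδ
  have hbad2 := measure_lintegral_bernoulliMixture_gt_le (n := n) P hgm hgI
    (gaussian b m (σ ^ 2)) hδ.1
  set bad1 := {s | √n * β * L < ‖A n s - m‖} with hb1
  set bad2 := {s : Fin n → X × Y | ENNReal.ofReal ((n + 1) / δ) <
      ∫⁻ c, bernoulliMixture (∫ z, g c z ∂P) (fun i => g c (s i)) ∂(gaussian b m (σ ^ 2))} with hb2
  set good := {s | klPlus (avgRisk loss pred (gaussian b (A n s) (σ ^ 2)) (empiricalMeasure s))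
              (avgRisk loss pred (gaussian b (A n s) (σ ^ 2)) P) ≤
            (((n * sensitivity A n ^ 2 / (2 * (σ : ℝ≥0∞) ^ 2) * ENNReal.ofReal (L ^ 2) +
                ENNReal.ofReal (Real.log ((n + 1) / δ))) / n : ℝ≥0∞) : EReal)} with hgood
  -- A cover suffices: subadditivity of the outer measure avoids any measurability of `good`.
  have hcover : Set.univ ⊆ good ∪ (bad1 ∪ bad2) := by
    intro s _
    by_cases h1 : s ∈ bad1
    · exact Or.inr (Or.inl h1)
    by_cases h2 : s ∈ bad2
    · exact Or.inr (Or.inr h2)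
    refine Or.inl ?_
    replace h1 : ‖A n s - m‖ ≤ √n * β * L := not_lt.1 h1
    rw [hb2, Set.mem_ofPred_eq, not_lt] at h2
    have h3 := klPlus_le_of_changeOfMeasure hn P hgm hgI (gaussian b (A n s) (σ ^ 2))
      (gaussian b m (σ ^ 2)) (by positivity) hM
      (integral_le_log_integral_exp_gaussian b (A n s) m hv) s h2
    have h4 : avgRisk loss pred (gaussian b (A n s) (σ ^ 2)) (empiricalMeasure s) =
        ∫ c, (∑ i, g c (s i)) / n ∂(gaussian b (A n s) (σ ^ 2)) :=
      integral_congr_ae (ae_of_all _ fun c => risk_empiricalMeasure loss (pred c) (hgc c) s)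
    have h5 : avgRisk loss pred (gaussian b (A n s) (σ ^ 2)) P =
        ∫ c, ∫ z, g c z ∂P ∂(gaussian b (A n s) (σ ^ 2)) := rfl
    rw [hgood, Set.mem_ofPred_eq, h4, h5]
    refine h3.trans ?_
    have hbound : (‖A n s - m‖ ^ 2 / (2 * (σ ^ 2 : ℝ≥0)) + Real.log ((n + 1) / δ)) / n ≤
        (n * β ^ 2 / (2 * (σ : ℝ) ^ 2) * L ^ 2 + Real.log ((n + 1) / δ)) / n := by
      have h6 : ‖A n s - m‖ ^ 2 ≤ n * β ^ 2 * L ^ 2 := by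
        calc _ ≤ (√n * β * L) ^ 2 := by gcongr
          _ = _ := by rw [mul_pow, mul_pow, Real.sq_sqrt hn0.le]
      gcongr
      rw [div_mul_eq_mul_div]
      push_cast
      gcongr
    have hval : ((n * sensitivity A n ^ 2 / (2 * (σ : ℝ≥0∞) ^ 2) * ENNReal.ofReal (L ^ 2) +
        ENNReal.ofReal (Real.log ((n + 1) / δ))) / n : ℝ≥0∞) = ENNReal.ofReal
        ((n * β ^ 2 / (2 * (σ : ℝ) ^ 2) * L ^ 2 + Real.log ((n + 1) / δ)) / n) := by
      have hlog := Real.log_nonneg hM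
      have hσr : (0 : ℝ) < σ := hσ
      rw [ENNReal.ofReal_div_of_pos hn0, ENNReal.ofReal_add (by positivity) hlog,
        ENNReal.ofReal_mul (by positivity), ENNReal.ofReal_div_of_pos (by positivity),
        ENNReal.ofReal_mul hn0.le, ENNReal.ofReal_mul zero_le_two,
        ENNReal.ofReal_pow ENNReal.toReal_nonneg, ENNReal.ofReal_pow hσr.le,
        ENNReal.ofReal_toReal htop]
      simp
    rw [hval, EReal.coe_ennreal_ofReal]
    exact_mod_cast hbound.trans (le_max_left _ _)
  have hone : 1 ≤ μ good + (ENNReal.ofReal δ + ENNReal.ofReal δ) := by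
    calc (1 : ℝ≥0∞) = μ Set.univ := measure_univ.symm
      _ ≤ μ (good ∪ (bad1 ∪ bad2)) := measure_mono hcover
      _ ≤ μ good + μ (bad1 ∪ bad2) := measure_union_le _ _
      _ ≤ μ good + (μ bad1 + μ bad2) := by gcongr; exact measure_union_le _ _
      _ ≤ _ := by gcongr
  rw [ENNReal.ofReal_sub _ (by positivity), ENNReal.ofReal_one, tsub_le_iff_right, two_mul,
    ENNReal.ofReal_add hδ0.le hδ0.le]
  exact hone
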